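/- Let $K$ be a field and let $S_1=\mathbb N\{\mathbf a_1,\dots,\mathbf a_m\}$ and $S_2=\mathbb N\{\mathbf b_1,\dots,\mathbf b_n\}$ be the affine semigroups generated by nonzero vectors of $\mathbb N^r$. Suppose that $S=S_1+S_2$ is the gluing of $S_1$ and $S_2$, i.e. there is a nonzero $\alpha\in S_1\cap S_2$ with $\mathbb ZS_1\cap\mathbb ZS_2=\mathbb Z\alpha$. Let $R=K[x_1,\dots,x_m,y_1,\dots,y_n]$ be graded by $S$ through $\deg x_i=\mathbf a_i$, $\deg y_j=\mathbf b_j$, and grade $K[x]=K[x_1,\dots,x_m]$ by $S_1$ and $K[y]=K[y_1,\dots,y_n]$ by $S_2$ in the same way. Let $I_{S_1}\subset K[x]$, $I_{S_2}\subset K[y]$ and $I_S\subset R$ be the toric ideals, i.e. the kernels of the maps to $K[t_1,\dots,t_r]$ with $x_i\mapsto \mathbf t^{\mathbf a_i}$, $y_j\mapsto\mathbf t^{\mathbf b_j}$. Write $\alpha=\sum_i u_i\mathbf a_i=\sum_j v_j\mathbf b_j$ with $u_i,v_j\in\mathbb N$ in any way, put $f_\alpha=\prod_i x_i^{u_i}-\prod_j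 y_j^{v_j}$, and let $\mathbf C_{f_\alpha}$ be the complex $0\to R[-\alpha]\xrightarrow{\,f_\alpha\,}R\to 0$ in homological degrees $1$ and $0$. A minimal graded free resolution of an ideal $I$ of a polynomial ring $P$ graded as above means here a bounded complex $\mathbf F$ of graded free $P$-modules of finite rank $F_i=\bigoplus_j P[-s_{i,j}]$, with all $s_{i,j}$ in the semigroup of degrees of $P$ and with degree-preserving differentials, such that $H_i(\mathbf F)=0$ for $i>0$, $H_0(\mathbf F)\cong P/I$ as graded modules, and the image of each differential $F_{i+1}\to F_i$ is contained in $\mathfrak mF_i$, where $\mathfrak m$ is the ideal generated by the variables of $P$. (a) If $\mathbf F$ is a minimal $S_1$-graded free resolution of $I_{S_1}$ over $K[x]$ and $\mathbf G$ is a minimal $S_2$-graded free resolution of $I_{S_2}$ over $K[y]$, then $\mathbf C_{f_\alpha}\otimes_R(R\otimes_{K[x]}\mathbf F)\otimes_R(R\otimes_{K[y]}\mathbf G)$, with the tensor product grading, is a minimal $S$-graded free resolution of $I_S$. (b) Likewise, if $\mathbf F$ and $\mathbf G$ are given directly over $R$, as minimal $S$-graded free resolutions of the extended ideals $I_{S_1}R$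 and $I_{S_2}R$ (so that $H_0(\mathbf F)\cong R/I_{S_1}R$ and $H_0(\mathbf G)\cong R/I_{S_2}R$), then $\mathbf C_{f_\alpha}\otimes_R\mathbf F\otimes_R\mathbf G$, with the tensor product grading, is a minimal $S$-graded free resolution of $I_S$. -/

import Mathlib

open CategoryTheory MonoidalCategory TensorProduct ChangeOfRings

universe u

noncomputable section

namespace Gluing

/-- The affine semigroup `ℕ{w i}` generated by a family of vectors of `ℕ^r`. -/
def affineSemigroup {σ : Type} {r : ℕ} (w : σ → Fin r → ℕ) : AddSubmonoid (Fin r → ℕ) :=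
  AddSubmonoid.closure (Set.range w)

/-- The subgroup `ℤS` of `ℤ^r` generated by a semigroup `S` in `ℕ^r`. -/
def groupSpan {r : ℕ} (S : AddSubmonoid (Fin r → ℕ)) : AddSubgroup (Fin r → ℤ) :=
  AddSubgroup.closure ((fun v k => (v k : ℤ)) '' (S : Set (Fin r → ℕ)))

/-- `S` is the gluing of `S₁` and `S₂` with gluing degree `α`: `S = S₁ + S₂`,
`0 ≠ α ∈ S₁ ∩ S₂` and `ℤS₁ ∩ ℤS₂ = ℤα`. -/
structure IsGluing {r : ℕ} (S S₁ S₂ : AddSubmonoid (Fin r → ℕ)) (α : Fin r → ℕ) : Prop where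
  eq_sup : S = S₁ ⊔ S₂
  ne_zero : α ≠ 0
  mem_left : α ∈ S₁
  mem_right : α ∈ S₂
  inf_eq : groupSpan S₁ ⊓ groupSpan S₂ = AddSubgroup.zmultiples (fun k => (α k : ℤ))

/-- The toric ideal of a family of vectors `w i` of `ℕ^r`: the kernel of the `K`-algebra map
`K[x_i] → K[t_1, …, t_r]`, `x_i ↦ t_1^{w i 1} ⋯ t_r^{w i r}`, whose image is the semigroup ring. -/
def toricIdeal (K : Type u) [Field K] {σ : Type} {r : ℕ} (w : σ → Fin r → ℕ) :
    Ideal (MvPolynomial σ K) :=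
  RingHom.ker (MvPolynomial.aeval (R := K)
    (fun i => ∏ k, (MvPolynomial.X k : MvPolynomial (Fin r) K) ^ w i k))

/-- The binomial `x_1^{u_1} ⋯ x_m^{u_m} - y_1^{v_1} ⋯ y_n^{v_n}` in `K[x, y]`. -/
def gluingBinomial (K : Type u) [Field K] {m n : ℕ} (μ : Fin m → ℕ) (ν : Fin n → ℕ) :
    MvPolynomial (Fin m ⊕ Fin n) K :=
  ∏ i, MvPolynomial.X (Sum.inl i) ^ μ i - ∏ j, MvPolynomial.X (Sum.inr j) ^ ν j

section GradedModules

variable {K : Type u} [Field K] {σ : Type} {r : ℕ}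

/-- Let `K[x]` be graded by `deg x_i = w i`, and let `gr t` be the piece of degree `t` of a module
`N`.  `IsGradedFree w gr` says that `N`, with these pieces, is a graded free module of finite rank
`⨁ K[x][-s_j]` with all `s_j` in the semigroup generated by the `w i`: there is a finite basis
`e_j` such that `gr t` consists of the sums of elements `c • e_j` with `c` homogeneous and
`deg c + s_j = t`. -/
def IsGradedFree (w : σ → Fin r → ℕ) {N : Type u} [AddCommGroup N] [Module (MvPolynomial σ K) N]
    (gr : (Fin r → ℕ) → AddSubgroup N) : Prop :=
  ∃ (β : ℕ) (e : Module.Basis (Fin β) (MvPolynomial σ K) N) (s : Fin β → Fin r → ℕ),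
    (∀ j, s j ∈ affineSemigroup w) ∧
    ∀ t, gr t = AddSubgroup.closure
      {x | ∃ (j : Fin β) (d : Fin r → ℕ) (c : MvPolynomial σ K),
        MvPolynomial.IsWeightedHomogeneous w c d ∧ d + s j = t ∧ x = c • e j}

/-- The family `gr i t` (the piece of degree `t` of `F_i`) makes the chain complex `F` a minimal
graded free resolution of `R/I` over `R = K[x]`, where `deg x_i = w i`. -/
structure IsMinimalGradedFreeResolution (w : σ → Fin r → ℕ) (I : Ideal (MvPolynomial σ K))
    (F : ChainComplex (ModuleCat.{u} (MvPolynomial σ K)) ℕ)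
    (gr : ∀ i, (Fin r → ℕ) → AddSubgroup (F.X i)) : Prop where
  /-- `F` has finite length. -/
  bounded : ∃ k, ∀ i, k < i → Subsingleton (F.X i)
  /-- Each `F_i` is graded free of finite rank. -/
  free : ∀ i, IsGradedFree (K := K) w (gr i)
  /-- The differentials preserve degrees. -/
  homogeneous : ∀ i t, ∀ x ∈ gr (i + 1) t, (F.d (i + 1) i).hom x ∈ gr i t
  /-- `H_i(F) = 0` for `i > 0`. -/
  exact : ∀ i, Function.Exact (F.d (i + 2) (i + 1)).hom (F.d (i + 1) i).hom
  /-- `H_0(F) = R/I`, as graded modules. -/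
  augmentation : ∃ ε : F.X 0 →ₗ[MvPolynomial σ K] (MvPolynomial σ K ⧸ I),
    Function.Surjective ε ∧ Function.Exact (F.d 1 0).hom ε ∧
    ∀ t, ∀ x ∈ gr 0 t, ∃ c : MvPolynomial σ K,
      MvPolynomial.IsWeightedHomogeneous w c t ∧ ε x = Ideal.Quotient.mk I c
  /-- Minimality: the image of each differential lies in `(x_i) F`. -/
  minimal : ∀ i, LinearMap.range (F.d (i + 1) i).hom ≤
    Ideal.span (Set.range (MvPolynomial.X : σ → MvPolynomial σ K)) •
      (⊤ : Submodule (MvPolynomial σ K) (F.X i))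

/-- The modules of the complex `0 → R → R → 0`, in homological degrees `1` and `0`. -/
def twoTermX (R : Type u) [CommRing R] : ℕ → ModuleCat.{u} R
  | 0 => ModuleCat.of R R
  | 1 => ModuleCat.of R R
  | _ + 2 => ModuleCat.of R PUnit

/-- The differentials of the complex `0 → R → R → 0` given by multiplication by `f`. -/
def twoTermD {R : Type u} [CommRing R] (f : R) : ∀ i j, twoTermX R i ⟶ twoTermX R j
  | 1, 0 => ModuleCat.ofHom (LinearMap.mulLeft R f)
  | 0, _ => 0
  | 1, _ + 1 => 0
  | _ + 2, _ => 0

/-- The complex `C_f : 0 → R → R → 0` given by multiplication by `f`. -/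
def twoTermComplex {R : Type u} [CommRing R] (f : R) : ChainComplex (ModuleCat.{u} R) ℕ where
  X := twoTermX R
  d := twoTermD f
  shape i j h := by
    match i, j with
    | 1, 0 => exact absurd rfl h
    | 0, _ => rfl
    | 1, _ + 1 => rfl
    | _ + 2, _ => rfl
  d_comp_d' i j k hij _ := by
    obtain rfl : j + 1 = i := hij
    match j with
    | 0 => exact Limits.comp_zero
    | _ + 1 => exact Limits.zero_comp

/-- The grading of `C_f` when `f` is homogeneous of degree `α`: `R` in homological degree `0`,
`R[-α]` in homological degree `1`. -/
def twoTermGrading (w : σ → Fin r → ℕ) (f : MvPolynomial σ K) (α : Fin r → ℕ) :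
    ∀ i, (Fin r → ℕ) → AddSubgroup ((twoTermComplex f).X i)
  | 0, t => (MvPolynomial.weightedHomogeneousSubmodule K w t).toAddSubgroup
  | 1, t => AddSubgroup.closure
      {c : MvPolynomial σ K | ∃ d, MvPolynomial.IsWeightedHomogeneous w c d ∧ d + α = t}
  | _ + 2, _ => ⊥

/-- The grading of the tensor product of two graded complexes: the piece of degree `t` is generated
by the `x ⊗ y` with `x`, `y` homogeneous and `deg x + deg y = t`. -/
def tensorGrading {R : Type u} [CommRing R] (F G : ChainComplex (ModuleCat.{u} R) ℕ)
    (grF : ∀ i, (Fin r → ℕ) → AddSubgroup (F.X i)) (grG : ∀ i, (Fin r → ℕ) → AddSubgroup (G.X i)) :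
    ∀ i, (Fin r → ℕ) → AddSubgroup ((F ⊗ G).X i) :=
  fun i t => AddSubgroup.closure
    {z | ∃ (p q : ℕ) (h : p + q = i) (t₁ t₂ : Fin r → ℕ) (x : F.X p) (y : G.X q),
      x ∈ grF p t₁ ∧ y ∈ grG q t₂ ∧ t₁ + t₂ = t ∧
      z = (HomologicalComplex.ιTensorObj F G p q i h).hom (x ⊗ₜ[R] y)}

variable {τ : Type}

/-- The inclusion `K[x_i : i ∈ σ] → K[x_j : j ∈ τ]` of polynomial rings given by an
inclusion `ι : σ → τ` of variables. -/
abbrev inclusion (K : Type u) [Field K] (ι : σ → τ) : MvPolynomial σ K →+* MvPolynomial τ K :=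
  (MvPolynomial.rename (R := K) ι).toRingHom

/-- Extension of scalars `F ↦ K[x_j : j ∈ τ] ⊗ F` of a complex along an inclusion of variables. -/
abbrev extend (ι : σ → τ) (F : ChainComplex (ModuleCat.{u} (MvPolynomial σ K)) ℕ) :
    ChainComplex (ModuleCat.{u} (MvPolynomial τ K)) ℕ :=
  ((ModuleCat.extendScalars.{u, u, u} (inclusion K ι)).mapHomologicalComplex
    (ComplexShape.down ℕ)).obj F

/-- The grading of the extension of scalars of a graded complex, where `deg x_j = w j` for `j ∈ τ`:
the piece of degree `t` is generated by the `c ⊗ x` with `c`, `x` homogeneous and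
`deg c + deg x = t`. -/
def extendGrading (ι : σ → τ) (w : τ → Fin r → ℕ)
    (F : ChainComplex (ModuleCat.{u} (MvPolynomial σ K)) ℕ)
    (gr : ∀ i, (Fin r → ℕ) → AddSubgroup (F.X i)) :
    ∀ i, (Fin r → ℕ) → AddSubgroup ((extend ι F).X i) :=
  fun i t => AddSubgroup.closure
    {z | ∃ (d s : Fin r → ℕ) (c : MvPolynomial τ K) (x : F.X i),
      MvPolynomial.IsWeightedHomogeneous w c d ∧ x ∈ gr i s ∧ d + s = t ∧
      z = c ⊗ₜ[MvPolynomial σ K, inclusion K ι] x}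

end GradedModules

end Gluing

end

/-! Write `I₁`, `I₂` for the extensions of the two toric ideals to `R = K[x, y]`, `J = I₁ + I₂`, and
`f` for the gluing binomial. The proof rests on the equality `I_S = (f) + J` (`toricIdeal_gluing`):
two monomials of equal `S`-degree have `S₁`-degrees differing by an element of `ℤS₁ ∩ ℤS₂ = ℤα`, so
trading powers of `x^μ` for powers of `y^ν` connects them modulo `J`.

A tensor product of minimal graded free resolutions of `R/I` and `R/I'` is automatically bounded,
graded free, homogeneous and minimal, with `H_0 = R/(I + I')`. Only acyclicity needs an argument,
and by `tensor_exact` it holds once the first resolution stays exact in positive degrees modulo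
`I'`. This is `IsMinimalGradedFreeResolution.tensor`, applied twice.

For `F ⊗ G`: over `K[y]` the ring `R` is free and `R/I₁` is projective, so a resolution of `R/I₁`
has a `K[y]`-linear contraction in positive degrees, which survives reduction modulo any ideal
extended from `K[y]` (`exact_mod_inclusion`).

For `C_f ⊗ (F ⊗ G)`: it suffices that `f` is a nonzerodivisor modulo `J`. Now `J` is the kernel of a
map to a polynomial ring in two disjoint blocks of variables, hence prime, and `f` is not in it
because `α ≠ 0` (`mem_sumToricIdeal_of_mul_mem`).

Part (a) reduces to part (b), since adjoining variables is flat
(`IsMinimalGradedFreeResolution.extend`). -/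

noncomputable section

namespace Gluing

/-! ### Inclusions, projections and the differential of a tensor product of complexes -/

section TensorComplex

variable {R : Type u} [CommRing R] (F G : ChainComplex (ModuleCat.{u} R) ℕ)

/-- The map `F_p ⊗ G_q → (F ⊗ G)_i`: the inclusion of a summand if `p + q = i`, zero otherwise. -/
def tensorι (p q i : ℕ) : F.X p ⊗[R] G.X q →ₗ[R] ((F ⊗ G).X i : ModuleCat R) :=
  if h : p + q = i then (HomologicalComplex.ιTensorObj F G p q i h).hom else 0

theorem tensorι_eq {p q i : ℕ} (h : p + q = i) :
    tensorι F G p q i = (HomologicalComplex.ιTensorObj F G p q i h).hom := dif_pos h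

theorem tensorι_of_ne {p q i : ℕ} (h : p + q ≠ i) : tensorι F G p q i = 0 := dif_neg h

variable {F G}

/-- The linear map out of `(F ⊗ G)_i` with prescribed restrictions to the summands. -/
def tensorDesc {i : ℕ} {N : Type u} [AddCommGroup N] [Module R N]
    (f : ∀ p q, F.X p ⊗[R] G.X q →ₗ[R] N) : ((F ⊗ G).X i : ModuleCat R) →ₗ[R] N :=
  (HomologicalComplex.mapBifunctorDesc (K₁ := F) (K₂ := G) (F := curriedTensor (ModuleCat R))
    (c := ComplexShape.down ℕ) (j := i) (A := ModuleCat.of R N)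
    (fun p q _ => ModuleCat.ofHom (f p q))).hom

theorem tensorDesc_ι {i : ℕ} {N : Type u} [AddCommGroup N] [Module R N]
    (f : ∀ p q, F.X p ⊗[R] G.X q →ₗ[R] N) {p q : ℕ} (h : p + q = i) (x : F.X p ⊗[R] G.X q) :
    tensorDesc f (tensorι F G p q i x) = f p q x := by
  rw [tensorι_eq F G h]
  exact congrArg (fun g => ModuleCat.Hom.hom g x)
    (HomologicalComplex.ι_mapBifunctorDesc (K₁ := F) (K₂ := G) (F := curriedTensor (ModuleCat R))
      (c := ComplexShape.down ℕ) (j := i) (A := ModuleCat.of R N)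
      (fun p q _ => ModuleCat.ofHom (f p q)) p q h)

theorem tensor_hom_ext {i : ℕ} {N : Type u} [AddCommGroup N] [Module R N]
    {f g : ((F ⊗ G).X i : ModuleCat R) →ₗ[R] N}
    (H : ∀ p q, p + q = i → ∀ x y,
      f (tensorι F G p q i (x ⊗ₜ y)) = g (tensorι F G p q i (x ⊗ₜ y))) : f = g := by
  have : ModuleCat.ofHom f = ModuleCat.ofHom g := by
    apply HomologicalComplex.mapBifunctor.hom_ext (K₁ := F) (K₂ := G)
      (F := curriedTensor (ModuleCat R)) (c := ComplexShape.down ℕ) (j := i)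
      (Y := ModuleCat.of R N)
    intro p q h
    apply ModuleCat.hom_ext
    have h' : p + q = i := h
    have key : f ∘ₗ tensorι F G p q i = g ∘ₗ tensorι F G p q i :=
      TensorProduct.ext' fun x y => H p q h' x y
    rw [tensorι_eq F G h'] at key
    exact key
  simpa using congrArg ModuleCat.Hom.hom this

/-- Truncated subtraction is harmless at `p = 0` or `q = 0`: the differential `d 0 0` vanishes, so
the corresponding term is zero. -/
theorem tensor_d_ι {p q i j : ℕ} (h : p + q = i) (hij : j + 1 = i) (x : F.X p) (y : G.X q) :
    ((F ⊗ G).d i j).hom (tensorι F G p q i (x ⊗ₜ y)) =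
      tensorι F G (p - 1) q j ((F.d p (p - 1)).hom x ⊗ₜ y) +
        (-1 : R) ^ p • tensorι F G p (q - 1) j (x ⊗ₜ (G.d q (q - 1)).hom y) := by
  rw [tensorι_eq F G h]
  have e₁ := congrArg (fun g => ModuleCat.Hom.hom g (x ⊗ₜ y))
    (HomologicalComplex.mapBifunctor.ι_D₁ F G (curriedTensor (ModuleCat R))
      (ComplexShape.down ℕ) i j p q h)
  have e₂ := congrArg (fun g => ModuleCat.Hom.hom g (x ⊗ₜ y))
    (HomologicalComplex.mapBifunctor.ι_D₂ F G (curriedTensor (ModuleCat R))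
      (ComplexShape.down ℕ) i j p q h)
  refine (congrArg₂ (· + ·) e₁ e₂).trans ?_
  refine congrArg₂ (· + ·) ?_ ?_
  · rcases p with _ | p
    · rw [HomologicalComplex.mapBifunctor.d₁_eq_zero]
      · simp
      · simp
    · have h' : p + q = j := by omega
      rw [HomologicalComplex.mapBifunctor.d₁_eq F G (curriedTensor (ModuleCat R))
        (ComplexShape.down ℕ) (i₁ := p + 1) (i₁' := p) (by simp) q j h']
      simp only [ComplexShape.ε₁_def, one_smul]
      change _ = tensorι F G p q j _
      rw [tensorι_eq F G h']
      rfl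
  · rcases q with _ | q
    · rw [HomologicalComplex.mapBifunctor.d₂_eq_zero]
      · simp
      · simp
    · have h' : p + q = j := by omega
      rw [HomologicalComplex.mapBifunctor.d₂_eq F G (curriedTensor (ModuleCat R))
        (ComplexShape.down ℕ) p (i₂ := q + 1) (i₂' := q) (by simp) j h']
      simp only [ComplexShape.ε₂_def, ComplexShape.ε_down_ℕ]
      change _ = (-1 : R) ^ p • tensorι F G p q j _
      rw [tensorι_eq F G h']
      rcases Nat.even_or_odd p with hp | hp
      · simp only [hp.neg_one_pow, one_smul]
        rfl
      · simp only [hp.neg_one_pow, neg_smul, one_smul, Units.neg_smul]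
        rfl

open Classical in
/-- The projection `(F ⊗ G)_i → F_p ⊗ G_q`. -/
def tensorπ (p q i : ℕ) : ((F ⊗ G).X i : ModuleCat R) →ₗ[R] F.X p ⊗[R] G.X q :=
  tensorDesc fun p' q' => if h : p' = p ∧ q' = q then
    (by obtain ⟨rfl, rfl⟩ := h; exact LinearMap.id) else 0

theorem tensorπ_ι_self {p q i : ℕ} (h : p + q = i) (x : F.X p ⊗[R] G.X q) :
    tensorπ p q i (tensorι F G p q i x) = x := by
  rw [tensorπ, tensorDesc_ι _ h, dif_pos ⟨rfl, rfl⟩]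
  rfl

theorem tensorπ_ι_of_ne {p q p' q' i : ℕ} (hp : p' ≠ p ∨ q' ≠ q) (x : F.X p' ⊗[R] G.X q') :
    tensorπ p q i (tensorι F G p' q' i x) = 0 := by
  by_cases h : p' + q' = i
  · rw [tensorπ, tensorDesc_ι _ h, dif_neg (by omega)]
    rfl
  · rw [tensorι_of_ne F G h]
    simp

theorem sum_tensorι_π {i : ℕ} (z : ((F ⊗ G).X i : ModuleCat R)) :
    ∑ a ∈ Finset.HasAntidiagonal.antidiagonal i, tensorι F G a.1 a.2 i (tensorπ a.1 a.2 i z) = z := by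
  have : ∑ a ∈ Finset.HasAntidiagonal.antidiagonal i, tensorι F G a.1 a.2 i ∘ₗ tensorπ a.1 a.2 i =
      LinearMap.id := by
    refine tensor_hom_ext fun p q h x y => ?_
    rw [LinearMap.sum_apply, Finset.sum_eq_single (p, q)]
    · simp [tensorπ_ι_self h]
    · rintro ⟨p', q'⟩ _ hne
      have : p ≠ p' ∨ q ≠ q' := by
        by_contra! hc
        exact hne (by rw [hc.1, hc.2])
      simp [tensorπ_ι_of_ne this]
    · intro hn
      exact absurd (Finset.HasAntidiagonal.mem_antidiagonal.2 h) hn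
  simpa using LinearMap.congr_fun this z

theorem tensorπ_injective {i : ℕ} {z : ((F ⊗ G).X i : ModuleCat R)}
    (hz : ∀ p q, p + q = i → tensorπ p q i z = 0) : z = 0 := by
  rw [← sum_tensorι_π z]
  refine Finset.sum_eq_zero fun a ha => ?_
  rw [hz _ _ (Finset.HasAntidiagonal.mem_antidiagonal.1 ha), map_zero]

theorem tensor_induction {i : ℕ} {P : ((F ⊗ G).X i : ModuleCat R) → Prop}
    (h0 : P 0) (hadd : ∀ x y, P x → P y → P (x + y))
    (hι : ∀ p q, p + q = i → ∀ x y, P (tensorι F G p q i (x ⊗ₜ y)))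
    (z : ((F ⊗ G).X i : ModuleCat R)) : P z := by
  rw [← sum_tensorι_π z]
  refine Finset.sum_induction _ P hadd h0 fun a ha => ?_
  generalize tensorπ a.1 a.2 i z = w
  induction w using TensorProduct.induction_on with
  | zero => simpa using h0
  | tmul x y => exact hι _ _ (Finset.HasAntidiagonal.mem_antidiagonal.1 ha) x y
  | add x y hx hy => rw [map_add]; exact hadd _ _ hx hy

/-- Only the two neighbouring summands map into a given one; this is what allows the double complex
to be chased one component at a time. -/
theorem tensorπ_d {p q i : ℕ} (h : p + q = i) (z : ((F ⊗ G).X (i + 1) : ModuleCat R)) :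
    tensorπ p q i (((F ⊗ G).d (i + 1) i).hom z) =
      LinearMap.rTensor (G.X q) (F.d (p + 1) p).hom (tensorπ (p + 1) q (i + 1) z) +
        (-1 : R) ^ p • LinearMap.lTensor (F.X p) (G.d (q + 1) q).hom
          (tensorπ p (q + 1) (i + 1) z) := by
  have : tensorπ p q i ∘ₗ ((F ⊗ G).d (i + 1) i).hom =
      LinearMap.rTensor (G.X q) (F.d (p + 1) p).hom ∘ₗ tensorπ (p + 1) q (i + 1) +
        (-1 : R) ^ p • LinearMap.lTensor (F.X p) (G.d (q + 1) q).hom ∘ₗ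
          tensorπ p (q + 1) (i + 1) := by
    refine tensor_hom_ext fun p' q' h' x y => ?_
    simp only [LinearMap.comp_apply, LinearMap.add_apply, LinearMap.smul_apply]
    rw [tensor_d_ι h' rfl, map_add, map_smul]
    refine congrArg₂ (· + ·) ?_ ?_
    · by_cases hp : p' = p + 1
      · obtain rfl : q' = q := by omega
        subst hp
        rw [tensorπ_ι_self h']
        exact tensorπ_ι_self h _
      · rw [tensorπ_ι_of_ne (Or.inl hp), map_zero]
        rcases p' with _ | p'
        · simp
        · exact tensorπ_ι_of_ne (Or.inl (by simpa using hp)) _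
    · by_cases hp : p' = p
      · obtain rfl : q' = q + 1 := by omega
        subst hp
        rw [tensorπ_ι_self h']
        exact congrArg _ (tensorπ_ι_self h _)
      · rw [tensorπ_ι_of_ne (Or.inl hp), tensorπ_ι_of_ne (Or.inl hp), map_zero, smul_zero,
          smul_zero]
  simpa using LinearMap.congr_fun this z

end TensorComplex

/-! ### Acyclicity of a tensor product of complexes -/

section Acyclicity

variable {R : Type u} [CommRing R] {F G : ChainComplex (ModuleCat.{u} R) ℕ}

/-- Since `M ⊗ R/J` is `M/JM`, every element has the form `x ⊗ 1`, and exactness can be tested on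
representatives in `M`. -/
theorem exact_rTensor_quotient {J : Ideal R} {M₁ M₂ M₃ : Type u} [AddCommGroup M₁] [AddCommGroup M₂]
    [AddCommGroup M₃] [Module R M₁] [Module R M₂] [Module R M₃] {f : M₁ →ₗ[R] M₂} {g : M₂ →ₗ[R] M₃}
    (hfg : g ∘ₗ f = 0)
    (h : ∀ x, g x ∈ J • (⊤ : Submodule R M₃) → ∃ y, x - f y ∈ J • (⊤ : Submodule R M₂)) :
    Function.Exact (LinearMap.rTensor (R ⧸ J) f) (LinearMap.rTensor (R ⧸ J) g) := by
  intro z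
  constructor
  · intro hz
    obtain ⟨x, rfl⟩ : ∃ x : M₂, z = x ⊗ₜ[R] (1 : R ⧸ J) := by
      obtain ⟨x, hx⟩ := Submodule.Quotient.mk_surjective _
        (TensorProduct.tensorQuotEquivQuotSMul M₂ J z)
      refine ⟨x, (TensorProduct.tensorQuotEquivQuotSMul M₂ J).injective ?_⟩
      rw [← hx, ← map_one (Ideal.Quotient.mk J), TensorProduct.tensorQuotEquivQuotSMul_tmul_mk,
        one_smul]
    have hz' := congrArg (TensorProduct.tensorQuotEquivQuotSMul M₃ J) hz
    rw [LinearMap.rTensor_tmul, ← map_one (Ideal.Quotient.mk J),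
      TensorProduct.tensorQuotEquivQuotSMul_tmul_mk, one_smul, map_zero,
      Submodule.Quotient.mk_eq_zero] at hz'
    obtain ⟨y, hy⟩ := h x hz'
    refine ⟨y ⊗ₜ 1, (TensorProduct.tensorQuotEquivQuotSMul M₂ J).injective ?_⟩
    rw [LinearMap.rTensor_tmul, ← map_one (Ideal.Quotient.mk J),
      TensorProduct.tensorQuotEquivQuotSMul_tmul_mk, TensorProduct.tensorQuotEquivQuotSMul_tmul_mk,
      one_smul, one_smul, eq_comm, Submodule.Quotient.eq]
    exact hy
  · rintro ⟨y, rfl⟩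
    rw [← LinearMap.comp_apply, ← LinearMap.rTensor_comp, hfg, LinearMap.rTensor_zero,
      LinearMap.zero_apply]

theorem rTensor_lTensor_comm {M M' N N' : Type u} [AddCommGroup M] [AddCommGroup M']
    [AddCommGroup N] [AddCommGroup N'] [Module R M] [Module R M'] [Module R N] [Module R N']
    (f : M →ₗ[R] M') (g : N →ₗ[R] N') (x : M ⊗[R] N) :
    LinearMap.rTensor N' f (LinearMap.lTensor M g x) =
      LinearMap.lTensor M' g (LinearMap.rTensor N f x) := by
  rw [← LinearMap.comp_apply, ← LinearMap.comp_apply, LinearMap.rTensor_comp_lTensor,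
    LinearMap.lTensor_comp_rTensor]

variable {N : Type u} [AddCommGroup N] [Module R N]

/-- If the `F_p` are flat, `G` is a resolution of `N` and `F ⊗ N` is exact in positive degrees,
then so is `F ⊗ G`. -/
theorem tensor_exact (hflat : ∀ p, Module.Flat R (F.X p))
    (hG : ∀ i, Function.Exact (G.d (i + 2) (i + 1)).hom (G.d (i + 1) i).hom)
    {ε : G.X 0 →ₗ[R] N} (hε : Function.Surjective ε) (hGε : Function.Exact (G.d 1 0).hom ε)
    (hF : ∀ i, Function.Exact (LinearMap.rTensor N (F.d (i + 2) (i + 1)).hom)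
      (LinearMap.rTensor N (F.d (i + 1) i).hom)) (i : ℕ) :
    Function.Exact ((F ⊗ G).d (i + 2) (i + 1)).hom ((F ⊗ G).d (i + 1) i).hom := by
  have hdd (z) : ((F ⊗ G).d (i + 1) i).hom (((F ⊗ G).d (i + 2) (i + 1)).hom z) = 0 :=
    congrArg (fun g => ModuleCat.Hom.hom g z) ((F ⊗ G).d_comp_d (i + 2) (i + 1) i)
  intro z
  refine ⟨fun hz => ?_, by rintro ⟨y, rfl⟩; exact hdd y⟩
  -- A cycle supported in the columns `p < k` is a boundary. Its rightmost component is a cycle for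
  -- the differential of `G`; it is killed by a correction that introduces nothing in columns `p ≥
  -- k`. The bound `k ≤ i + 1` keeps the `G`-degree of the component positive, where `G` is exact.
  have column : ∀ k, k ≤ i + 1 → ∀ z, ((F ⊗ G).d (i + 1) i).hom z = 0 →
      (∀ p q, p + q = i + 1 → k ≤ p → tensorπ p q (i + 1) z = 0) →
      ∃ y, ((F ⊗ G).d (i + 2) (i + 1)).hom y = z := by
    intro k
    induction k with
    | zero =>
      intro _ z _ h
      exact ⟨0, by rw [map_zero, tensorπ_injective fun p q hpq => h p q hpq (Nat.zero_le p)]⟩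
    | succ k ih =>
      intro hk z hz h
      obtain ⟨q, hq⟩ : ∃ q, k + q = i := ⟨i - k, by omega⟩
      have h₁ := tensorπ_d hq z
      rw [hz, map_zero, h (k + 1) q (by omega) le_rfl, map_zero, zero_add] at h₁
      have h₂ : LinearMap.lTensor (F.X k) (G.d (q + 1) q).hom (tensorπ k (q + 1) (i + 1) z) = 0 := by
        have := congrArg ((-1 : R) ^ k • ·) h₁
        simpa [smul_smul, ← mul_pow] using this.symm
      have := hflat k
      obtain ⟨w, hw⟩ := (Module.Flat.lTensor_exact (F.X k) (hG q) _).1 h₂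
      -- The sign in the correction cancels the sign that the total differential puts on the
      -- differential of `G`.
      obtain ⟨y, hy⟩ := ih (by omega)
        (z - ((F ⊗ G).d (i + 2) (i + 1)).hom ((-1 : R) ^ k • tensorι F G k (q + 2) (i + 2) w))
        (by rw [map_sub, hz, hdd, sub_zero]) (by
          intro p q' hpq hp
          rw [map_sub, map_smul, map_smul, tensorπ_d hpq, tensorπ_ι_of_ne (Or.inl (by omega)),
            map_zero, zero_add]
          obtain rfl | hne := eq_or_ne p k
          · obtain rfl : q' = q + 1 := by omega
            rw [tensorπ_ι_self (by omega), hw, smul_smul, ← mul_pow]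
            simp
          · rw [h p q' hpq (by omega), tensorπ_ι_of_ne (Or.inl hne.symm), map_zero, smul_zero,
              smul_zero, sub_zero])
      exact ⟨y + (-1 : R) ^ k • tensorι F G k (q + 2) (i + 2) w, by rw [map_add, hy]; abel⟩
  -- first remove the component in `F_{i+1} ⊗ G_0`
  have h₁ := tensorπ_d (add_zero i) z
  rw [hz, map_zero] at h₁
  -- Applying `F_i ⊗ ε` kills the contribution of `G_1`, so the last component becomes a cycle of `F
  -- ⊗ N`.
  have h₂ : LinearMap.rTensor N (F.d (i + 1) i).hom
      (LinearMap.lTensor (F.X (i + 1)) ε (tensorπ (i + 1) 0 (i + 1) z)) = 0 := by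
    have h₃ := congrArg (LinearMap.lTensor (F.X i) ε) h₁
    rw [map_zero, map_add, map_smul] at h₃
    have h₄ : LinearMap.lTensor (F.X i) ε (LinearMap.lTensor (F.X i) (G.d 1 0).hom
      (tensorπ i 1 (i + 1) z)) = 0 := (lTensor_exact (F.X i) hGε hε).apply_apply_eq_zero _
    rw [rTensor_lTensor_comm]
    exact (h₃.trans ((congrArg (_ + (-1 : R) ^ i • ·) h₄).trans (by simp))).symm
  obtain ⟨w', hw'⟩ := (hF i _).1 h₂
  obtain ⟨w, rfl⟩ := LinearMap.lTensor_surjective (F.X (i + 2)) hε w'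
  rw [rTensor_lTensor_comm] at hw'
  obtain ⟨v, hv⟩ := (lTensor_exact (F.X (i + 1)) hGε hε
    (tensorπ (i + 1) 0 (i + 1) z - LinearMap.rTensor (G.X 0) (F.d (i + 2) (i + 1)).hom w)).1
      (by rw [map_sub, hw', sub_self])
  -- `w` matches the component in `F_{i+1} ⊗ G_0` after applying `ε`, and `v` corrects the remaining
  -- error in the kernel of `ε`. Together they make the boundary of `u` agree with `z` in that
  -- component.
  set u : ((F ⊗ G).X (i + 2) : ModuleCat R) := tensorι F G (i + 2) 0 (i + 2) w +
    (-1 : R) ^ (i + 1) • tensorι F G (i + 1) 1 (i + 2) v with hu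
  obtain ⟨y, hy⟩ := column (i + 1) le_rfl (z - ((F ⊗ G).d (i + 2) (i + 1)).hom u)
    (by rw [map_sub, hz, hdd, sub_zero]) (by
      intro p q hpq hp
      obtain rfl : p = i + 1 := by omega
      obtain rfl : q = 0 := by omega
      have hu₁ : tensorπ (i + 2) 0 (i + 2) u = w := by
        rw [hu, map_add, map_smul, tensorπ_ι_self (by omega), tensorπ_ι_of_ne (Or.inl (by omega)),
          smul_zero, add_zero]
      have hu₂ : tensorπ (i + 1) 1 (i + 2) u = (-1 : R) ^ (i + 1) • v := by
        rw [hu, map_add, map_smul, tensorπ_ι_self (by omega), tensorπ_ι_of_ne (Or.inl (by omega)),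
          zero_add]
      rw [map_sub, tensorπ_d hpq]
      change _ - (LinearMap.rTensor (G.X 0) (F.d (i + 2) (i + 1)).hom (tensorπ (i + 2) 0 (i + 2) u) +
        (-1 : R) ^ (i + 1) • LinearMap.lTensor (F.X (i + 1)) (G.d 1 0).hom
          (tensorπ (i + 1) 1 (i + 2) u)) = 0
      rw [hu₁, hu₂, map_smul, hv, smul_smul, ← mul_pow]
      simp)
  exact ⟨y + u, by rw [map_add, hy]; abel⟩

end Acyclicity

/-! ### Additive closures and submodules `I • ⊤` under additive and linear maps -/

section Closure

variable {M N P : Type*} [AddCommGroup M] [AddCommGroup N] [AddCommGroup P]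

theorem map_mem_of_mem_closure (f : M →+ P) {S : Set M} {H : AddSubgroup P}
    (h : ∀ x ∈ S, f x ∈ H) {x : M} (hx : x ∈ AddSubgroup.closure S) : f x ∈ H :=
  (AddSubgroup.closure_le (H.comap f)).2 h hx

theorem map₂_mem_of_mem_closure (f : M →+ N →+ P) {S : Set M} {T : Set N} {H : AddSubgroup P}
    (h : ∀ x ∈ S, ∀ y ∈ T, f x y ∈ H) {x : M} {y : N} (hx : x ∈ AddSubgroup.closure S)
    (hy : y ∈ AddSubgroup.closure T) : f x y ∈ H :=
  map_mem_of_mem_closure (f.flip y) (H := H)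
    (fun x' hx' => map_mem_of_mem_closure (f x') (h x' hx') hy) hx

theorem neg_one_pow_smul_mem {R : Type*} [CommRing R] [Module R P] (H : AddSubgroup P) (n : ℕ)
    {x : P} (hx : x ∈ H) : (-1 : R) ^ n • x ∈ H := by
  rcases neg_one_pow_eq_or R n with h | h <;> rw [h]
  · rwa [one_smul]
  · rw [neg_smul, one_smul]
    exact H.neg_mem hx

theorem map_mem_smul_top {R : Type*} [CommRing R] [Module R M] [Module R N] (I : Ideal R)
    (f : M →ₗ[R] N) {x : M} (hx : x ∈ I • (⊤ : Submodule R M)) : f x ∈ I • (⊤ : Submodule R N) := by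
  have := Submodule.mem_map_of_mem (f := f) hx
  rw [Submodule.map_smul''] at this
  exact Submodule.smul_mono le_rfl le_top this

end Closure

/-! ### The isomorphism of `R/I ⊗ R/J` with `R/(I + J)` -/

section QuotientMul

variable {R : Type u} [CommRing R] (I J : Ideal R)

/-- The multiplication map `R/I ⊗ R/J → R/(I + J)`. -/
def quotientMul : (R ⧸ I) ⊗[R] (R ⧸ J) →ₗ[R] R ⧸ (I ⊔ J) :=
  TensorProduct.lift ((LinearMap.mul R (R ⧸ (I ⊔ J))).compl₁₂
    (Submodule.factor (le_sup_left : I ≤ I ⊔ J)) (Submodule.factor (le_sup_right : J ≤ I ⊔ J)))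

theorem quotientMul_tmul (a b : R) :
    quotientMul I J (Ideal.Quotient.mk I a ⊗ₜ Ideal.Quotient.mk J b) =
      Ideal.Quotient.mk (I ⊔ J) (a * b) := rfl

/-- The source is cyclic, generated by `1 ⊗ 1`, and `I` kills this generator through the left
factor, `J` through the right one. -/
theorem quotientMul_injective : Function.Injective (quotientMul I J) := by
  rw [injective_iff_map_eq_zero]
  intro z hz
  obtain ⟨r, rfl⟩ : ∃ r : R, r • ((1 : R ⧸ I) ⊗ₜ[R] (1 : R ⧸ J)) = z := by
    clear hz
    induction z using TensorProduct.induction_on with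
    | zero => exact ⟨0, by simp⟩
    | tmul x y =>
      obtain ⟨a, rfl⟩ := Ideal.Quotient.mk_surjective x
      obtain ⟨b, rfl⟩ := Ideal.Quotient.mk_surjective y
      refine ⟨a * b, ?_⟩
      rw [← TensorProduct.smul_tmul_smul, Algebra.smul_def, Algebra.smul_def, mul_one, mul_one]
      rfl
    | add x y hx hy =>
      obtain ⟨a, rfl⟩ := hx
      obtain ⟨b, rfl⟩ := hy
      exact ⟨a + b, add_smul _ _ _⟩
  rw [map_smul, ← map_one (Ideal.Quotient.mk I), ← map_one (Ideal.Quotient.mk J),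
    quotientMul_tmul, one_mul, Algebra.smul_def, map_one, mul_one] at hz
  obtain ⟨a, ha, b, hb, rfl⟩ := Submodule.mem_sup.1 (Ideal.Quotient.eq_zero_iff_mem.1 hz)
  rw [add_smul, TensorProduct.smul_tmul', ← TensorProduct.tmul_smul, Algebra.smul_def,
    Algebra.smul_def, mul_one, mul_one]
  rw [show algebraMap R (R ⧸ I) a = 0 from Ideal.Quotient.eq_zero_iff_mem.2 ha,
    show algebraMap R (R ⧸ J) b = 0 from Ideal.Quotient.eq_zero_iff_mem.2 hb,
    TensorProduct.zero_tmul, TensorProduct.tmul_zero, add_zero]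

end QuotientMul

/-! ### Bases of the terms of a tensor product of complexes -/

section TensorBasis

variable {R : Type u} [CommRing R] (F G : ChainComplex (ModuleCat.{u} R) ℕ)

/-- `(F ⊗ G)_i` is the direct sum of the `F_p ⊗ G_q` with `p + q = i`. -/
def tensorPiEquiv (i : ℕ) : ((F ⊗ G).X i : ModuleCat R) ≃ₗ[R]
    ∀ a : (Finset.HasAntidiagonal.antidiagonal i : Finset (ℕ × ℕ)), F.X a.1.1 ⊗[R] G.X a.1.2 :=
  LinearEquiv.ofLinearMap
    (LinearMap.pi fun a => tensorπ a.1.1 a.1.2 i)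
    (∑ a : (Finset.HasAntidiagonal.antidiagonal i : Finset (ℕ × ℕ)),
      tensorι F G a.1.1 a.1.2 i ∘ₗ LinearMap.proj a)
    (by
      refine LinearMap.pi_ext' fun a => LinearMap.ext fun x => funext fun b => ?_
      have ha := Finset.HasAntidiagonal.mem_antidiagonal.1 a.2
      simp only [LinearMap.comp_apply, LinearMap.sum_apply, LinearMap.pi_apply, LinearMap.id_apply,
        LinearMap.proj_apply, LinearMap.single_apply]
      rw [Finset.sum_eq_single a]
      · rw [Pi.single_eq_same]
        obtain rfl | hne := eq_or_ne b a
        · rw [tensorπ_ι_self ha, Pi.single_eq_same]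
        · rw [Pi.single_eq_of_ne hne, tensorπ_ι_of_ne]
          by_contra! hc
          exact hne (Subtype.ext (Prod.ext hc.1.symm hc.2.symm))
      · intro c _ hc
        rw [Pi.single_eq_of_ne hc, map_zero]
      · simp)
    (by
      refine LinearMap.ext fun z => ?_
      simp only [LinearMap.comp_apply, LinearMap.sum_apply, LinearMap.id_apply,
        LinearMap.proj_apply, LinearMap.pi_apply]
      rw [Finset.sum_coe_sort (Finset.HasAntidiagonal.antidiagonal i)
        (fun a => tensorι F G a.1 a.2 i (tensorπ a.1 a.2 i z)), sum_tensorι_π])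

theorem tensorPiEquiv_symm_single {i : ℕ}
    (a : (Finset.HasAntidiagonal.antidiagonal i : Finset (ℕ × ℕ))) (x : F.X a.1.1 ⊗[R] G.X a.1.2) :
    (tensorPiEquiv F G i).symm (Pi.single a x) = tensorι F G a.1.1 a.1.2 i x := by
  change (∑ a : (Finset.HasAntidiagonal.antidiagonal i : Finset (ℕ × ℕ)),
      tensorι F G a.1.1 a.1.2 i ∘ₗ LinearMap.proj a) (Pi.single a x) = _
  rw [LinearMap.sum_apply, Finset.sum_eq_single a]
  · simp
  · intro c _ hc
    simp [Pi.single_eq_of_ne hc]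
  · simp

variable {F G} {β γ : ℕ → Type}

/-- The basis of `(F ⊗ G)_i` given by bases of the `F_p` and `G_q`. -/
def tensorBasis (e : ∀ p, Module.Basis (β p) R (F.X p)) (e' : ∀ q, Module.Basis (γ q) R (G.X q))
    (i : ℕ) :
    Module.Basis (Σ a : (Finset.HasAntidiagonal.antidiagonal i : Finset (ℕ × ℕ)),
      β a.1.1 × γ a.1.2) R ((F ⊗ G).X i : ModuleCat R) :=
  (Pi.basis fun a => (e a.1.1).tensorProduct (e' a.1.2)).map (tensorPiEquiv F G i).symm

theorem tensorBasis_apply (e : ∀ p, Module.Basis (β p) R (F.X p))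
    (e' : ∀ q, Module.Basis (γ q) R (G.X q)) (i : ℕ)
    (a : (Finset.HasAntidiagonal.antidiagonal i : Finset (ℕ × ℕ))) (j : β a.1.1) (k : γ a.1.2) :
    tensorBasis e e' i ⟨a, j, k⟩ = tensorι F G a.1.1 a.1.2 i (e a.1.1 j ⊗ₜ e' a.1.2 k) := by
  rw [tensorBasis, Module.Basis.map_apply, Pi.basis_apply, tensorPiEquiv_symm_single,
    Module.Basis.tensorProduct_apply]

end TensorBasis

/-! ### Tensor products of minimal graded free resolutions -/

section TensorResolution

variable {K : Type u} [Field K] {σ : Type} {r : ℕ} {w : σ → Fin r → ℕ}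

theorem isGradedFree_of_basis {N : Type u} [AddCommGroup N] [Module (MvPolynomial σ K) N]
    {gr : (Fin r → ℕ) → AddSubgroup N} {ι : Type*} [Finite ι]
    (e : Module.Basis ι (MvPolynomial σ K) N) (s : ι → Fin r → ℕ)
    (hs : ∀ j, s j ∈ affineSemigroup w)
    (hgr : ∀ t, gr t = AddSubgroup.closure
      {x | ∃ (j : ι) (d : Fin r → ℕ) (c : MvPolynomial σ K),
        MvPolynomial.IsWeightedHomogeneous w c d ∧ d + s j = t ∧ x = c • e j}) :
    IsGradedFree (K := K) w gr := by
  obtain ⟨β, ⟨f⟩⟩ := Finite.exists_equiv_fin ι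
  refine ⟨β, e.reindex f, s ∘ f.symm, fun j => hs _, fun t => ?_⟩
  rw [hgr]
  congr 1
  ext x
  constructor
  · rintro ⟨j, d, c, h₁, h₂, h₃⟩
    exact ⟨f j, d, c, h₁, by simpa using h₂, by simpa using h₃⟩
  · rintro ⟨j, d, c, h₁, h₂, h₃⟩
    exact ⟨f.symm j, d, c, h₁, h₂, by simpa using h₃⟩

variable {F G : ChainComplex (ModuleCat.{u} (MvPolynomial σ K)) ℕ}
  {grF : ∀ i, (Fin r → ℕ) → AddSubgroup (F.X i)} {grG : ∀ i, (Fin r → ℕ) → AddSubgroup (G.X i)}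

theorem tensorGrading_eq (i : ℕ) (t : Fin r → ℕ) :
    tensorGrading F G grF grG i t = AddSubgroup.closure
      {z | ∃ (p q : ℕ) (_ : p + q = i) (t₁ t₂ : Fin r → ℕ) (x : F.X p) (y : G.X q),
        x ∈ grF p t₁ ∧ y ∈ grG q t₂ ∧ t₁ + t₂ = t ∧ z = tensorι F G p q i (x ⊗ₜ y)} := by
  rw [tensorGrading]
  congr 1
  ext z
  constructor
  · rintro ⟨p, q, h, t₁, t₂, x, y, hx, hy, ht, hz⟩
    exact ⟨p, q, h, t₁, t₂, x, y, hx, hy, ht, by rw [tensorι_eq F G h]; exact hz⟩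
  · rintro ⟨p, q, h, t₁, t₂, x, y, hx, hy, ht, hz⟩
    rw [tensorι_eq F G h] at hz
    exact ⟨p, q, h, t₁, t₂, x, y, hx, hy, ht, hz⟩

theorem tensorι_mem_tensorGrading {p q i : ℕ} (h : p + q = i) {t₁ t₂ t : Fin r → ℕ} {x : F.X p}
    {y : G.X q} (hx : x ∈ grF p t₁) (hy : y ∈ grG q t₂) (ht : t₁ + t₂ = t) :
    tensorι F G p q i (x ⊗ₜ y) ∈ tensorGrading F G grF grG i t := by
  rw [tensorGrading_eq]
  exact AddSubgroup.subset_closure ⟨p, q, h, t₁, t₂, x, y, hx, hy, ht, rfl⟩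

/-- The products of basis elements form the required basis, and their shifts add. -/
theorem isGradedFree_tensorGrading (hF : ∀ i, IsGradedFree (K := K) w (grF i))
    (hG : ∀ i, IsGradedFree (K := K) w (grG i)) (i : ℕ) :
    IsGradedFree (K := K) w (tensorGrading F G grF grG i) := by
  choose β e s hs hgr using hF
  choose γ e' s' hs' hgr' using hG
  refine isGradedFree_of_basis (tensorBasis e e' i)
    (fun b => s b.1.1.1 b.2.1 + s' b.1.1.2 b.2.2)
    (fun b => add_mem (hs _ _) (hs' _ _)) fun t => ?_
  rw [tensorGrading_eq]
  refine le_antisymm ((AddSubgroup.closure_le _).2 ?_) ((AddSubgroup.closure_le _).2 ?_)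
  · rintro _ ⟨p, q, h, t₁, t₂, x, y, hx, hy, ht, rfl⟩
    rw [hgr] at hx
    rw [hgr'] at hy
    refine map₂_mem_of_mem_closure
      (AddMonoidHom.mk' (fun x => AddMonoidHom.mk' (fun y => tensorι F G p q i (x ⊗ₜ y))
          fun y y' => by rw [TensorProduct.tmul_add, map_add])
        fun x x' => by ext y; simp [TensorProduct.add_tmul]) ?_ hx hy
    rintro _ ⟨j, d, c, hc, hd, rfl⟩ _ ⟨k, d', c', hc', hd', rfl⟩
    refine AddSubgroup.subset_closure
      ⟨⟨⟨(p, q), Finset.HasAntidiagonal.mem_antidiagonal.2 h⟩, j, k⟩, d + d', c * c',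
        hc.mul hc', ?_, ?_⟩
    · simp only [← ht, ← hd, ← hd']
      abel
    · have hb := tensorBasis_apply e e' i ⟨(p, q), Finset.HasAntidiagonal.mem_antidiagonal.2 h⟩ j k
      have hm := TensorProduct.smul_tmul_smul c c' (e p j) (e' q k)
      exact (congrArg (tensorι F G p q i) hm).trans
        ((map_smul _ _ _).trans (congrArg ((c * c') • ·) hb.symm))
  · rintro _ ⟨⟨⟨⟨p, q⟩, h⟩, j, k⟩, d, c, hc, hd, rfl⟩
    have hb := (congrArg (c • ·) (tensorBasis_apply e e' i ⟨(p, q), h⟩ j k)).trans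
      ((map_smul (tensorι F G p q i) c (e p j ⊗ₜ e' q k)).symm.trans
        (congrArg (tensorι F G p q i) (TensorProduct.smul_tmul' c (e p j) (e' q k))))
    -- The coefficient is absorbed into the left factor; the right factor is a basis element with
    -- coefficient `1` of degree `0`.
    refine AddSubgroup.subset_closure ⟨p, q, Finset.HasAntidiagonal.mem_antidiagonal.1 h, d + s p j,
      s' q k, c • e p j, e' q k, ?_, ?_, ?_, hb⟩
    · rw [hgr]
      exact AddSubgroup.subset_closure ⟨j, d, c, hc, rfl, rfl⟩
    · rw [hgr']
      exact AddSubgroup.subset_closure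
        ⟨k, 0, 1, MvPolynomial.isWeightedHomogeneous_one K w, zero_add _, (one_smul _ _).symm⟩
    · rw [add_assoc]
      exact hd

theorem tensorGrading_homogeneous
    (hF : ∀ i t, ∀ x ∈ grF (i + 1) t, (F.d (i + 1) i).hom x ∈ grF i t)
    (hG : ∀ i t, ∀ x ∈ grG (i + 1) t, (G.d (i + 1) i).hom x ∈ grG i t)
    (i : ℕ) (t : Fin r → ℕ) (x : ((F ⊗ G).X (i + 1) : ModuleCat (MvPolynomial σ K)))
    (hx : x ∈ tensorGrading F G grF grG (i + 1) t) :
    ((F ⊗ G).d (i + 1) i).hom x ∈ tensorGrading F G grF grG i t := by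
  rw [tensorGrading_eq] at hx
  refine map_mem_of_mem_closure ((F ⊗ G).d (i + 1) i).hom.toAddMonoidHom ?_ hx
  rintro _ ⟨p, q, h, t₁, t₂, x, y, hx, hy, ht, rfl⟩
  change ((F ⊗ G).d (i + 1) i).hom _ ∈ _
  rw [tensor_d_ι h rfl]
  refine add_mem ?_ (neg_one_pow_smul_mem _ _ ?_)
  · rcases p with _ | p
    · simp
    · exact tensorι_mem_tensorGrading (by omega) (hF _ _ _ hx) hy ht
  · rcases q with _ | q
    · simp
    · exact tensorι_mem_tensorGrading (by omega) hx (hG _ _ _ hy) ht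

theorem IsMinimalGradedFreeResolution.free_X {I : Ideal (MvPolynomial σ K)}
    (hF : IsMinimalGradedFreeResolution w I F grF) (i : ℕ) :
    Module.Free (MvPolynomial σ K) (F.X i) := by
  obtain ⟨β, e, -⟩ := hF.free i
  exact Module.Free.of_basis e

/-- Let `F`, `G` be minimal graded free resolutions of `R/I`, `R/J`.  If `F ⊗ R/J` is exact in
positive degrees, then `F ⊗ G` is a minimal graded free resolution of `R/(I + J)`. -/
theorem IsMinimalGradedFreeResolution.tensor {I J : Ideal (MvPolynomial σ K)}
    (hF : IsMinimalGradedFreeResolution w I F grF) (hG : IsMinimalGradedFreeResolution w J G grG)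
    (hFJ : ∀ i x, (F.d (i + 1) i).hom x ∈ J • (⊤ : Submodule (MvPolynomial σ K) (F.X i)) →
      ∃ y, x - (F.d (i + 2) (i + 1)).hom y ∈ J • (⊤ : Submodule (MvPolynomial σ K) (F.X (i + 1)))) :
    IsMinimalGradedFreeResolution w (I ⊔ J) (F ⊗ G) (tensorGrading F G grF grG) where
  bounded := by
    obtain ⟨k, hk⟩ := hF.bounded
    obtain ⟨l, hl⟩ := hG.bounded
    refine ⟨k + l, fun i hi => subsingleton_of_forall_eq 0 fun z => tensorπ_injective ?_⟩
    intro p q h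
    by_cases hp : k < p
    · have := hk p hp
      exact Subsingleton.elim _ _
    · have := hl q (by omega)
      exact Subsingleton.elim _ _
  free := isGradedFree_tensorGrading hF.free hG.free
  homogeneous := tensorGrading_homogeneous hF.homogeneous hG.homogeneous
  exact := by
    obtain ⟨ε, hε, hGε, -⟩ := hG.augmentation
    refine tensor_exact (fun p => ?_) hG.exact hε hGε fun i =>
      exact_rTensor_quotient ?_ (hFJ i)
    · have := hF.free_X p
      infer_instance
    · exact congrArg ModuleCat.Hom.hom (F.d_comp_d (i + 2) (i + 1) i)
  augmentation := by
    obtain ⟨ε, hε, hFε, hεgr⟩ := hF.augmentation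
    obtain ⟨ε', hε', hGε, hεgr'⟩ := hG.augmentation
    have hι (x) (y) : (quotientMul I J ∘ₗ TensorProduct.map ε ε' ∘ₗ tensorπ 0 0 0)
        (tensorι F G 0 0 0 (x ⊗ₜ y)) = quotientMul I J (ε x ⊗ₜ ε' y) := by
      simp [tensorπ_ι_self (zero_add 0)]
    have hd : ∀ y, tensorπ 0 0 0 (((F ⊗ G).d 1 0).hom y) =
        LinearMap.rTensor (G.X 0) (F.d 1 0).hom (tensorπ 1 0 1 y) +
        LinearMap.lTensor (F.X 0) (G.d 1 0).hom (tensorπ 0 1 1 y) := fun y => by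
      have := tensorπ_d (zero_add 0) y
      rwa [pow_zero, one_smul] at this
    refine ⟨quotientMul I J ∘ₗ TensorProduct.map ε ε' ∘ₗ tensorπ 0 0 0, ?_, ?_, ?_⟩
    · intro c
      obtain ⟨c, rfl⟩ := Ideal.Quotient.mk_surjective c
      obtain ⟨x, hx⟩ := hε (Ideal.Quotient.mk I c)
      obtain ⟨y, hy⟩ := hε' (Ideal.Quotient.mk J 1)
      exact ⟨tensorι F G 0 0 0 (x ⊗ₜ y), by rw [hι, hx, hy, quotientMul_tmul, mul_one]⟩
    · intro z
      -- By right exactness the kernel of `ε ⊗ ε'` is the sum of the images of `F_0 ⊗ G_1` and `F_1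
      -- ⊗ G_0`, which are the two contributions to the boundary in degree zero.
      have hker := TensorProduct.map_ker hFε hε hGε hε'
      have hz : (quotientMul I J ∘ₗ TensorProduct.map ε ε' ∘ₗ tensorπ 0 0 0) z = 0 ↔
          tensorπ 0 0 0 z ∈ LinearMap.ker (TensorProduct.map ε ε') := by
        rw [LinearMap.mem_ker]
        exact map_eq_zero_iff _ (quotientMul_injective I J)
      rw [hz, hker]
      constructor
      · intro h
        obtain ⟨_, ⟨v, rfl⟩, _, ⟨u, rfl⟩, huv⟩ := Submodule.mem_sup.1 h
        refine ⟨tensorι F G 1 0 1 u + tensorι F G 0 1 1 v, ?_⟩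
        have h₁ : tensorπ 1 0 1 (tensorι F G 1 0 1 u + tensorι F G 0 1 1 v) = u := by
          rw [map_add, tensorπ_ι_self (by omega), tensorπ_ι_of_ne (Or.inl (by omega)), add_zero]
        have h₂ : tensorπ 0 1 1 (tensorι F G 1 0 1 u + tensorι F G 0 1 1 v) = v := by
          rw [map_add, tensorπ_ι_self (by omega), tensorπ_ι_of_ne (Or.inl (by omega)), zero_add]
        rw [← sub_eq_zero]
        refine tensorπ_injective fun p q hpq => ?_
        obtain rfl : p = 0 := by omega
        obtain rfl : q = 0 := by omega
        rw [map_sub, hd, h₁, h₂, ← huv]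
        abel
      · rintro ⟨y, rfl⟩
        rw [hd, add_comm]
        exact Submodule.add_mem_sup ⟨_, rfl⟩ ⟨_, rfl⟩
    · intro t x hx
      rw [tensorGrading_eq] at hx
      -- Elements of a graded piece are sums of pure tensors, so the target is taken to be the
      -- additive group of classes of homogeneous polynomials of degree `t`.
      have := map_mem_of_mem_closure
        (H := (((MvPolynomial.weightedHomogeneousSubmodule K w t).toAddSubgroup).map
          (Ideal.Quotient.mk (I ⊔ J)).toAddMonoidHom))
        (quotientMul I J ∘ₗ TensorProduct.map ε ε' ∘ₗ tensorπ 0 0 0).toAddMonoidHom ?_ hx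
      · obtain ⟨c, hc, hc'⟩ := this
        exact ⟨c, hc, hc'.symm⟩
      rintro _ ⟨p, q, h, t₁, t₂, x, y, hx, hy, ht, rfl⟩
      obtain rfl : p = 0 := by omega
      obtain rfl : q = 0 := by omega
      obtain ⟨c, hc, hc'⟩ := hεgr _ _ hx
      obtain ⟨c₁, hc₁, hc₁'⟩ := hεgr' _ _ hy
      refine ⟨c * c₁, ?_, ?_⟩
      · rw [← ht]
        exact hc.mul hc₁
      · change Ideal.Quotient.mk (I ⊔ J) (c * c₁) =
          (quotientMul I J ∘ₗ TensorProduct.map ε ε' ∘ₗ tensorπ 0 0 0) _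
        rw [hι, hc', hc₁', quotientMul_tmul]
  minimal i := by
    rintro _ ⟨z, rfl⟩
    induction z using tensor_induction with
    | h0 => rw [map_zero]; exact zero_mem _
    | hadd x y hx hy => rw [map_add]; exact add_mem hx hy
    | hι p q h x y =>
      rw [tensor_d_ι h rfl]
      refine add_mem ?_ (Submodule.smul_mem _ _ ?_)
      · rcases p with _ | p
        · simp
        · exact map_mem_smul_top _ (tensorι F G p q i ∘ₗ (TensorProduct.mk _ _ _).flip y)
            (hF.minimal p ⟨x, rfl⟩)
      · rcases q with _ | q
        · simp
        · exact map_mem_smul_top _ (tensorι F G p q i ∘ₗ TensorProduct.mk _ _ _ x)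
            (hG.minimal q ⟨y, rfl⟩)

end TensorResolution

/-! ### The two-term complex of a homogeneous element -/

section TwoTerm

variable {K : Type u} [Field K] {σ : Type} {r : ℕ} {w : σ → Fin r → ℕ}

theorem isGradedFree_singleton {s : Fin r → ℕ} (hs : s ∈ affineSemigroup w)
    {gr : (Fin r → ℕ) → AddSubgroup (MvPolynomial σ K)}
    (hgr : ∀ t, gr t = AddSubgroup.closure
      {c | ∃ d, MvPolynomial.IsWeightedHomogeneous w c d ∧ d + s = t}) :
    IsGradedFree (K := K) w gr := by
  refine isGradedFree_of_basis (Module.Basis.singleton Unit _) (fun _ => s) (fun _ => hs)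
    fun t => ?_
  rw [hgr]
  congr 1
  ext c
  simp

/-- The complex `C_f` is a minimal graded free resolution of `R/(f)`. -/
theorem isMinimalGradedFreeResolution_twoTerm {f : MvPolynomial σ K} {α : Fin r → ℕ}
    (hf : MvPolynomial.IsWeightedHomogeneous w f α) (hα : α ∈ affineSemigroup w) (hf0 : f ≠ 0)
    (hfm : f ∈ Ideal.span (Set.range (MvPolynomial.X : σ → MvPolynomial σ K))) :
    IsMinimalGradedFreeResolution w (Ideal.span {f}) (twoTermComplex f) (twoTermGrading w f α) where
  bounded := ⟨1, fun i hi => by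
    match i, hi with
    | i + 2, _ => exact inferInstanceAs (Subsingleton PUnit)⟩
  free i := by
    match i with
    | 0 =>
      refine isGradedFree_singleton (zero_mem _) fun t => ?_
      simp only [add_zero, exists_eq_right]
      exact (AddSubgroup.closure_eq
        (MvPolynomial.weightedHomogeneousSubmodule K w t).toAddSubgroup).symm
    | 1 => exact isGradedFree_singleton hα fun t => rfl
    | i + 2 =>
      have : Subsingleton ((twoTermComplex f).X (i + 2)) := inferInstanceAs (Subsingleton PUnit)
      exact isGradedFree_of_basis (Module.Basis.empty (ι := Empty) _) (fun j => j.elim)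
        (fun j => j.elim) fun t => Subsingleton.elim _ _
  homogeneous i t x hx := by
    match i with
    | 0 =>
      refine map_mem_of_mem_closure (LinearMap.mulLeft (MvPolynomial σ K) f).toAddMonoidHom
        (H := (MvPolynomial.weightedHomogeneousSubmodule K w t).toAddSubgroup) ?_ hx
      rintro c ⟨d, hc, rfl⟩
      rw [add_comm]
      exact hf.mul hc
    | i + 1 => exact zero_mem _
  exact i := by
    match i with
    | 0 =>
      intro x
      constructor
      · intro hx
        have hx' : f * (show MvPolynomial σ K from x) = 0 := hx
        exact ⟨0, ((mul_eq_zero.1 hx').resolve_left hf0).symm⟩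
      · rintro ⟨y, rfl⟩
        exact mul_zero f
    | i + 1 =>
      intro x
      exact ⟨fun _ => ⟨0, rfl⟩, fun _ => rfl⟩
  augmentation := by
    let ε : (twoTermComplex f).X 0 →ₗ[MvPolynomial σ K] (MvPolynomial σ K ⧸ Ideal.span {f}) :=
      Submodule.mkQ (R := MvPolynomial σ K) (M := MvPolynomial σ K) (Ideal.span {f})
    refine ⟨ε, Submodule.mkQ_surjective (R := MvPolynomial σ K) (Ideal.span {f}), fun x => ?_,
      fun t x hx => ⟨x, hx, rfl⟩⟩
    refine (Submodule.Quotient.mk_eq_zero _).trans (Ideal.mem_span_singleton'.trans ?_)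
    exact exists_congr fun y => by rw [mul_comm]; rfl
  minimal i := by
    rintro _ ⟨x, rfl⟩
    match i with
    | 0 =>
      have : f • (show MvPolynomial σ K from x) ∈
          Ideal.span (Set.range (MvPolynomial.X : σ → MvPolynomial σ K)) •
            (⊤ : Submodule (MvPolynomial σ K) (MvPolynomial σ K)) :=
        Submodule.smul_mem_smul hfm trivial
      exact this
    | i + 1 => exact zero_mem _

/-- If `f` is a nonzerodivisor modulo `J` then `C_f ⊗ R/J` is exact in positive degrees. -/
theorem twoTerm_exact_mod {R : Type u} [CommRing R] {f : R} {J : Ideal R}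
    (hfJ : ∀ g, f * g ∈ J → g ∈ J) (i : ℕ) (x : (twoTermComplex f).X (i + 1))
    (hx : ((twoTermComplex f).d (i + 1) i).hom x ∈
      J • (⊤ : Submodule R ((twoTermComplex f).X i))) :
    ∃ y, x - ((twoTermComplex f).d (i + 2) (i + 1)).hom y ∈
      J • (⊤ : Submodule R ((twoTermComplex f).X (i + 1))) := by
  -- No boundary is needed: in degree `1` the hypothesis on `f` already puts `x` in `J`, and all
  -- higher terms are zero.
  refine ⟨0, ?_⟩
  rw [map_zero, sub_zero]
  match i with
  | 0 =>
    have hx' : f * (show R from x) ∈ J • (⊤ : Submodule R R) := hx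
    rw [smul_eq_mul, Ideal.mul_top] at hx'
    have : (show R from x) ∈ J • (⊤ : Submodule R R) := by
      rw [smul_eq_mul, Ideal.mul_top]
      exact hfJ _ hx'
    exact this
  | i + 1 => exact zero_mem _

end TwoTerm

/-! ### Contractions, and exactness modulo an extended ideal -/

section Contraction

variable {B : Type*} [CommRing B] {X : ℕ → Type*} [∀ i, AddCommGroup (X i)] [∀ i, Module B (X i)]
  {M : Type*} [AddCommGroup M] [Module B M]

theorem exists_lift_of_exact {P Q N L : Type*} [AddCommGroup P] [AddCommGroup Q] [AddCommGroup N]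
    [AddCommGroup L] [Module B P] [Module B Q] [Module B N] [Module B L] [Module.Projective B P]
    {f : Q →ₗ[B] N} {g : N →ₗ[B] L} (hfg : Function.Exact f g) (φ : P →ₗ[B] N)
    (hφ : ∀ x, g (φ x) = 0) : ∃ ψ : P →ₗ[B] Q, ∀ x, f (ψ x) = φ x := by
  obtain ⟨ψ, hψ⟩ := Module.projective_lifting_property f.rangeRestrict
    (φ.codRestrict f.range fun x => (hfg _).1 (hφ x)) f.surjective_rangeRestrict
  exact ⟨ψ, fun x => congrArg Subtype.val (LinearMap.congr_fun hψ x)⟩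

/-- A bounded below exact complex of projective modules is contractible. -/
theorem exists_contraction [∀ i, Module.Projective B (X i)] [Module.Projective B M]
    (d : ∀ i, X (i + 1) →ₗ[B] X i) (hd : ∀ i, Function.Exact (d (i + 1)) (d i))
    (ε : X 0 →ₗ[B] M) (hε : Function.Surjective ε) (hdε : Function.Exact (d 0) ε) (i : ℕ) :
    ∃ (h : X i →ₗ[B] X (i + 1)) (h' : X (i + 1) →ₗ[B] X (i + 2)),
      ∀ x, d (i + 1) (h' x) + h (d i x) = x := by
  have step (i : ℕ) (h : X i →ₗ[B] X (i + 1)) (hh : ∀ x, d i (h (d i x)) = d i x) :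
      ∃ h' : X (i + 1) →ₗ[B] X (i + 2), ∀ x, d (i + 1) (h' x) + h (d i x) = x := by
    obtain ⟨h', hh'⟩ := exists_lift_of_exact (hd i) (LinearMap.id - h ∘ₗ d i)
      (fun x => by simp [hh])
    exact ⟨h', fun x => by simp [hh']⟩
  -- The condition `d h d = d` is what the induction can carry: it makes `id - h d` land in the
  -- kernel of `d`, so that this map lifts to the next stage of the contraction. The start comes
  -- from a section of `ε`, which exists because `M` is projective.
  have main : ∃ h : X i →ₗ[B] X (i + 1), ∀ x, d i (h (d i x)) = d i x := by
    induction i with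
    | zero =>
      obtain ⟨s, hs⟩ := Module.projective_lifting_property ε LinearMap.id hε
      have hs' (x) : ε (s x) = x := LinearMap.congr_fun hs x
      obtain ⟨h, hh⟩ := exists_lift_of_exact hdε (LinearMap.id - s ∘ₗ ε) (fun x => by simp [hs'])
      exact ⟨h, fun x => by simp [hh, hdε.apply_apply_eq_zero]⟩
    | succ i ih =>
      obtain ⟨h, hh⟩ := ih
      obtain ⟨h', hh'⟩ := step i h hh
      refine ⟨h', fun x => ?_⟩
      have := hh' (d (i + 1) x)
      rwa [(hd i).apply_apply_eq_zero, map_zero, add_zero] at this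
  obtain ⟨h, hh⟩ := main
  obtain ⟨h', hh'⟩ := step i h hh
  exact ⟨h, h', hh'⟩

/-- The map is only `B`-linear, but `JR • M` is additively generated by the elements `b • x` with `b
∈ J`, and these are respected. -/
theorem map_mem_map_smul_top {R : Type*} [CommRing R] [Algebra B R] {M N : Type*} [AddCommGroup M]
    [AddCommGroup N] [Module B M] [Module B N] [Module R M] [Module R N] [IsScalarTower B R M]
    [IsScalarTower B R N] (J : Ideal B) (h : M →ₗ[B] N) {x : M}
    (hx : x ∈ J.map (algebraMap B R) • (⊤ : Submodule R M)) :
    h x ∈ J.map (algebraMap B R) • (⊤ : Submodule R N) := by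
  have key : ∀ c ∈ J.map (algebraMap B R), ∀ x : M,
      h (c • x) ∈ J.map (algebraMap B R) • (⊤ : Submodule R N) := by
    intro c hc
    induction hc using Submodule.span_induction with
    | mem c hc =>
      obtain ⟨b, hb, rfl⟩ := hc
      intro x
      rw [algebraMap_smul, map_smul, ← algebraMap_smul R b]
      exact Submodule.smul_mem_smul (Ideal.mem_map_of_mem _ hb) trivial
    | zero => simp
    | add c c' _ _ hc hc' =>
      intro x
      rw [add_smul, map_add]
      exact add_mem (hc x) (hc' x)
    | smul a c _ hc =>
      intro x
      rw [smul_eq_mul, mul_comm, mul_smul]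
      exact hc _
  induction hx using Submodule.smul_induction_on' with
  | smul c hc x _ => exact key c hc x
  | add x _ y _ hx hy =>
    rw [map_add]
    exact add_mem hx hy

/-- Let `R` be a free `B`-algebra such that `R/I` is projective over `B`.  If `F` is a free
resolution of `R/I` over `R` then `F ⊗ R/JR` is exact in positive degrees for each ideal `J` of
`B`. -/
theorem exact_mod_map {B R : Type u} [CommRing B] [CommRing R] [Algebra B R] [Module.Free B R]
    {I : Ideal R} [Module.Projective B (R ⧸ I)] (J : Ideal B)
    {F : ChainComplex (ModuleCat.{u} R) ℕ} (hfree : ∀ i, Module.Free R (F.X i))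
    (hF : ∀ i, Function.Exact (F.d (i + 2) (i + 1)).hom (F.d (i + 1) i).hom)
    {ε : F.X 0 →ₗ[R] (R ⧸ I)} (hε : Function.Surjective ε)
    (hFε : Function.Exact (F.d 1 0).hom ε) (i : ℕ) (x : F.X (i + 1))
    (hx : (F.d (i + 1) i).hom x ∈ J.map (algebraMap B R) • (⊤ : Submodule R (F.X i))) :
    ∃ y, x - (F.d (i + 2) (i + 1)).hom y ∈
      J.map (algebraMap B R) • (⊤ : Submodule R (F.X (i + 1))) := by
  let (i : ℕ) : Module B (F.X i) := Module.compHom _ (algebraMap B R)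
  have (i : ℕ) : IsScalarTower B R (F.X i) := ⟨fun b c x => by
    rw [Algebra.smul_def, mul_smul]
    rfl⟩
  have (i : ℕ) : Module.Free B (F.X i) := Module.Free.trans (S := R)
  obtain ⟨h, h', hh⟩ := exists_contraction (B := B) (X := fun i => F.X i)
    (fun i => (F.d (i + 1) i).hom.restrictScalars B) hF (ε.restrictScalars B) hε hFε i
  -- The contraction gives `x - d (h' x) = h (d x)`, and the `B`-linear map `h` preserves
  -- divisibility by `J`.
  refine ⟨h' x, ?_⟩
  rw [show x - (F.d (i + 2) (i + 1)).hom (h' x) = h ((F.d (i + 1) i).hom x) from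
    sub_eq_of_eq_add' (hh x).symm]
  exact map_mem_map_smul_top J h hx

end Contraction

/-! ### Freeness, projectivity and flatness for an extension by variables -/

section PolynomialExtension

open MvPolynomial

variable {K : Type u} [Field K] {σ τ : Type} {B : Type*} [CommRing B] [Algebra K B]

/-- If `I` is an ideal of `K[x]` then `B[x]/I B[x]` is projective over `B`. -/
theorem projective_quotient_map (I : Ideal (MvPolynomial σ K)) :
    Module.Projective B (MvPolynomial σ B ⧸ I.map (MvPolynomial.map (σ := σ) (algebraMap K B))) := by
  set φ : MvPolynomial σ K →+* MvPolynomial σ B := MvPolynomial.map (algebraMap K B) with hφ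
  -- Over a field the subspace `I` of `K[x]` has a linear retraction `π`. Its `B`-linear extension
  -- `ρ`, defined on monomials, will be a retraction of `B[x]` onto `I B[x]`, making the quotient a
  -- direct summand of a free module.
  obtain ⟨π, hπ⟩ := (I.restrictScalars K).subtype.exists_leftInverse_of_injective
    (Submodule.ker_subtype _)
  have hπI (a) (ha : a ∈ I) : (π a : MvPolynomial σ K) = a :=
    congrArg Subtype.val (LinearMap.congr_fun hπ ⟨a, ha⟩)
  let ρ : MvPolynomial σ B →ₗ[B] MvPolynomial σ B :=
    (basisMonomials σ B).constr B fun s => φ (π (monomial s 1))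
  have hρm (s : σ →₀ ℕ) (b : B) : ρ (monomial s b) = b • φ (π (monomial s 1)) := by
    have := (basisMonomials σ B).constr_basis B (fun s => φ (π (monomial s 1))) s
    rw [coe_basisMonomials] at this
    rw [show monomial s b = b • monomial s (1 : B) by rw [smul_monomial, smul_eq_mul, mul_one],
      map_smul]
    exact congrArg (b • ·) this
  have hρφ (a : MvPolynomial σ K) : ρ (φ a) = φ (π a) := by
    induction a using MvPolynomial.induction_on' with
    | monomial s c =>
      rw [hφ, map_monomial, hρm, show monomial s c = c • monomial s (1 : K) by
        rw [smul_monomial, smul_eq_mul, mul_one], map_smul]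
      rw [Submodule.coe_smul, smul_eq_C_mul, smul_eq_C_mul, map_mul, hφ, map_C]
    | add p q hp hq => rw [map_add, map_add, hp, hq, map_add, Submodule.coe_add, map_add]
  have hρ_mem (x) : ρ x ∈ I.map φ := by
    induction x using MvPolynomial.induction_on' with
    | monomial s b =>
      rw [hρm, smul_eq_C_mul]
      exact Ideal.mul_mem_left _ _ (Ideal.mem_map_of_mem _ (π _).2)
    | add p q hp hq => rw [map_add]; exact add_mem hp hq
  have hρ_mul (a) (ha : a ∈ I) (p : MvPolynomial σ B) : ρ (p * φ a) = p * φ a := by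
    induction p using MvPolynomial.induction_on' with
    | monomial s b =>
      have : monomial s b * φ a = b • φ (monomial s 1 * a) := by
        rw [map_mul, hφ, map_monomial, map_one, ← smul_mul_assoc, smul_monomial, smul_eq_mul,
          mul_one]
      rw [this, map_smul, hρφ, hπI _ (I.mul_mem_left _ ha)]
    | add p q hp hq => rw [add_mul, map_add, hp, hq]
  have hρ_id (x) (hx : x ∈ I.map φ) : ρ x = x := by
    -- `ρ` is not `B[x]`-linear, so the induction must carry an arbitrary multiplier.
    suffices ∀ p, ρ (p * x) = p * x by simpa using this 1
    induction hx using Submodule.span_induction with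
    | mem x hx =>
      obtain ⟨a, ha, rfl⟩ := hx
      exact hρ_mul a ha
    | zero => simp
    | add x y _ _ hx hy => intro p; rw [mul_add, map_add, hx, hy]
    | smul c x _ hx => intro p; rw [smul_eq_mul, ← mul_assoc, hx]
  have : Module.Projective B (MvPolynomial σ B ⧸ (I.map φ).restrictScalars B) := by
    -- `id - ρ` vanishes on `I B[x]`, and the map it induces on the quotient is a section of the
    -- projection.
    refine Module.Projective.of_split
      (((I.map φ).restrictScalars B).liftQ (LinearMap.id - ρ) fun x hx => ?_)
      ((I.map φ).restrictScalars B).mkQ ?_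
    · rw [LinearMap.mem_ker, LinearMap.sub_apply, hρ_id x hx, LinearMap.id_apply, sub_self]
    · refine Submodule.linearMap_qext _ (LinearMap.ext fun x => ?_)
      simp only [LinearMap.comp_apply, Submodule.mkQ_apply, Submodule.liftQ_apply,
        LinearMap.id_apply, LinearMap.sub_apply]
      rw [Submodule.Quotient.eq, Submodule.restrictScalars_mem]
      simpa using neg_mem (hρ_mem x)
  exact Module.Projective.of_equiv (Submodule.Quotient.restrictScalarsEquiv B (I.map φ))

theorem sumAlgEquiv_inclusion_inr (p : MvPolynomial τ K) :
    sumAlgEquiv K σ τ (inclusion K Sum.inr p) = C p :=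
  DFunLike.congr_fun (sumAlgEquiv_comp_rename_inr (R := K) (S₁ := σ) (S₂ := τ)) p

theorem sumAlgEquiv_inclusion_inl (p : MvPolynomial σ K) :
    sumAlgEquiv K σ τ (inclusion K Sum.inl p) = MvPolynomial.map (algebraMap K _) p :=
  DFunLike.congr_fun (sumAlgEquiv_comp_rename_inl (R := K) (S₁ := σ) (S₂ := τ)) p

/-- `K[x, y] ≅ K[y][x]` as algebras over `K[y]`. -/
def sumEquivOver : letI := (inclusion K (Sum.inr : τ → σ ⊕ τ)).toAlgebra
    MvPolynomial (σ ⊕ τ) K ≃ₐ[MvPolynomial τ K] MvPolynomial σ (MvPolynomial τ K) :=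
  letI := (inclusion K (Sum.inr : τ → σ ⊕ τ)).toAlgebra
  AlgEquiv.ofRingEquiv (f := (sumAlgEquiv K σ τ).toRingEquiv) sumAlgEquiv_inclusion_inr

theorem free_inclusion_inr : letI := (inclusion K (Sum.inr : τ → σ ⊕ τ)).toAlgebra
    Module.Free (MvPolynomial τ K) (MvPolynomial (σ ⊕ τ) K) := by
  let := (inclusion K (Sum.inr : τ → σ ⊕ τ)).toAlgebra
  exact Module.Free.of_equiv (sumEquivOver (K := K) (σ := σ) (τ := τ)).symm.toLinearEquiv

/-- Under `K[x, y] ≅ K[y][x]` the extension of `I` becomes `I K[y][x]`, so `projective_quotient_map`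
applies with `B = K[y]`. -/
theorem projective_quotient_inclusion (I : Ideal (MvPolynomial σ K)) :
    let := (inclusion K (Sum.inr : τ → σ ⊕ τ)).toAlgebra
    Module.Projective (MvPolynomial τ K)
      (MvPolynomial (σ ⊕ τ) K ⧸ I.map (inclusion K (Sum.inl : σ → σ ⊕ τ))) := by
  let := (inclusion K (Sum.inr : τ → σ ⊕ τ)).toAlgebra
  have := projective_quotient_map (B := MvPolynomial τ K) I
  refine Module.Projective.of_equiv
    (Ideal.quotientEquivAlg (I.map (inclusion K (Sum.inl : σ → σ ⊕ τ)))
      (I.map (MvPolynomial.map (algebraMap K (MvPolynomial τ K))))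
      (sumEquivOver (K := K) (σ := σ) (τ := τ)) ?_).symm.toLinearEquiv
  rw [Ideal.map_map]
  congr 1
  exact RingHom.ext fun p => (sumAlgEquiv_inclusion_inl p).symm

/-- This is Tor-independence of two ideals in disjoint sets of variables: a resolution modulo the
`x`-ideal is contractible over `K[y]` in positive degrees, hence stays exact modulo the `y`-ideal.
-/
theorem exact_mod_inclusion {I : Ideal (MvPolynomial σ K)} (J : Ideal (MvPolynomial τ K)) {r : ℕ}
    {w : σ ⊕ τ → Fin r → ℕ} {F : ChainComplex (ModuleCat.{u} (MvPolynomial (σ ⊕ τ) K)) ℕ}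
    {grF : ∀ i, (Fin r → ℕ) → AddSubgroup (F.X i)}
    (hF : IsMinimalGradedFreeResolution w (I.map (inclusion K Sum.inl)) F grF) (i : ℕ)
    (x : F.X (i + 1))
    (hx : (F.d (i + 1) i).hom x ∈ J.map (inclusion K (Sum.inr : τ → σ ⊕ τ)) •
      (⊤ : Submodule (MvPolynomial (σ ⊕ τ) K) (F.X i))) :
    ∃ y, x - (F.d (i + 2) (i + 1)).hom y ∈ J.map (inclusion K (Sum.inr : τ → σ ⊕ τ)) •
      (⊤ : Submodule (MvPolynomial (σ ⊕ τ) K) (F.X (i + 1))) := by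
  let := (inclusion K (Sum.inr : τ → σ ⊕ τ)).toAlgebra
  have := free_inclusion_inr (K := K) (σ := σ) (τ := τ)
  have := projective_quotient_inclusion (τ := τ) I
  obtain ⟨ε, hε, hFε, -⟩ := hF.augmentation
  exact exact_mod_map J hF.free_X hF.exact hε hFε i x hx

theorem flat_inclusion_inr : (inclusion K (Sum.inr : τ → σ ⊕ τ)).Flat := by
  let := (inclusion K (Sum.inr : τ → σ ⊕ τ)).toAlgebra
  have := free_inclusion_inr (K := K) (σ := σ) (τ := τ)
  exact Module.Flat.of_free

/-- Swapping the two blocks of variables is an isomorphism that reduces this to the other inclusion.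
-/
theorem flat_inclusion_inl : (inclusion K (Sum.inl : σ → σ ⊕ τ)).Flat := by
  have : inclusion K (Sum.inl : σ → σ ⊕ τ) = ((renameEquiv K (Equiv.sumComm τ σ)).toRingEquiv :
      MvPolynomial (τ ⊕ σ) K →+* MvPolynomial (σ ⊕ τ) K).comp (inclusion K Sum.inr) := by
    refine RingHom.ext fun p => ?_
    change rename Sum.inl p = rename (Equiv.sumComm τ σ) (rename Sum.inr p)
    rw [rename_rename]
    rfl
  rw [this]
  exact flat_inclusion_inr.comp (RingHom.Flat.of_bijective (RingEquiv.bijective _))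

end PolynomialExtension

/-! ### Toric ideals, their binomials, and the toric ideal of a gluing -/

section Toric

open MvPolynomial

variable {K : Type u} [Field K] {σ τ ρ : Type} {r : ℕ}

/-- The homomorphism `x_i ↦ t^{W i}` of polynomial rings. -/
def monomialHom (K : Type u) [Field K] (W : σ → ρ →₀ ℕ) : MvPolynomial σ K →ₐ[K] MvPolynomial ρ K :=
  aeval fun i => monomial (W i) 1

theorem monomialHom_monomial (W : σ → ρ →₀ ℕ) (s : σ →₀ ℕ) (c : K) :
    monomialHom K W (monomial s c) = monomial (Finsupp.weight W s) c := by
  rw [monomialHom, aeval_monomial, Finsupp.weight_apply, monomial_finsupp_sum_index]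
  simp [monomial_pow, algebraMap_eq]

/-- The kernel of `x_i ↦ t^{W i}` is spanned by binomials. -/
theorem ker_monomialHom_le (W : σ → ρ →₀ ℕ) (J : Ideal (MvPolynomial σ K))
    (h : ∀ s t, Finsupp.weight W s = Finsupp.weight W t →
      (monomial s 1 - monomial t 1 : MvPolynomial σ K) ∈ J) :
    RingHom.ker (monomialHom K W) ≤ J := by
  -- `L` sends each monomial in the image to a chosen monomial preimage, with irrelevant values
  -- elsewhere. Modulo `J` a monomial equals the chosen one of the same weight, so `L` inverts the
  -- homomorphism modulo `J`.
  let L : MvPolynomial ρ K →ₗ[K] MvPolynomial σ K :=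
    (basisMonomials ρ K).constr K fun d => monomial (Function.invFun (Finsupp.weight W) d) 1
  have hL (d : ρ →₀ ℕ) (c : K) :
      L (monomial d c) = monomial (Function.invFun (Finsupp.weight W) d) c := by
    have := (basisMonomials ρ K).constr_basis K
      (fun d => monomial (Function.invFun (Finsupp.weight W) d) (1 : K)) d
    rw [coe_basisMonomials] at this
    rw [show monomial d c = c • monomial d (1 : K) by rw [smul_monomial, smul_eq_mul, mul_one],
      map_smul]
    exact (congrArg (c • ·) this).trans (by simp [smul_monomial])
  have key (p : MvPolynomial σ K) : p - L (monomialHom K W p) ∈ J := by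
    induction p using MvPolynomial.induction_on' with
    | monomial s c =>
      rw [monomialHom_monomial, hL]
      have := J.mul_mem_left (C c) (h s _ (Function.invFun_eq ⟨s, rfl⟩).symm)
      simpa [mul_sub, C_mul_monomial] using this
    | add p q hp hq =>
      rw [map_add, map_add, add_sub_add_comm]
      exact add_mem hp hq
  intro p hp
  have := key p
  rwa [show monomialHom K W p = 0 from hp, map_zero, sub_zero] at this

theorem binomial_mem_ker (W : σ → ρ →₀ ℕ) {s t : σ →₀ ℕ}
    (h : Finsupp.weight W s = Finsupp.weight W t) :
    (monomial s 1 - monomial t 1 : MvPolynomial σ K) ∈ RingHom.ker (monomialHom K W) := by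
  rw [RingHom.mem_ker, map_sub, monomialHom_monomial, monomialHom_monomial, h, sub_self]

theorem toricIdeal_eq_ker (w : σ → Fin r → ℕ) :
    toricIdeal K w = RingHom.ker (monomialHom K fun i => Finsupp.equivFunOnFinite.symm (w i)) := by
  rw [toricIdeal, monomialHom]
  congr 2
  funext i
  rw [monomial_eq, C_1, one_mul, Finsupp.prod_fintype _ _ (by simp)]
  simp

theorem weight_equivFunOnFinite [Fintype ρ] (w : σ → ρ → ℕ) (s : σ →₀ ℕ) :
    Finsupp.weight (fun i => Finsupp.equivFunOnFinite.symm (w i)) s =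
      Finsupp.equivFunOnFinite.symm (Finsupp.weight w s) := by
  ext k
  simp [Finsupp.weight_apply, Finsupp.sum, Finsupp.finsetSum_apply, Finset.sum_apply]

theorem toricIdeal_le (w : σ → Fin r → ℕ) (J : Ideal (MvPolynomial σ K))
    (h : ∀ s t, Finsupp.weight w s = Finsupp.weight w t →
      (monomial s 1 - monomial t 1 : MvPolynomial σ K) ∈ J) : toricIdeal K w ≤ J := by
  rw [toricIdeal_eq_ker]
  refine ker_monomialHom_le _ J fun s t hst => h s t ?_
  rw [weight_equivFunOnFinite, weight_equivFunOnFinite] at hst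
  exact Finsupp.equivFunOnFinite.symm.injective hst

theorem binomial_mem_toricIdeal (w : σ → Fin r → ℕ) {s t : σ →₀ ℕ}
    (h : Finsupp.weight w s = Finsupp.weight w t) :
    (monomial s 1 - monomial t 1 : MvPolynomial σ K) ∈ toricIdeal K w := by
  rw [toricIdeal_eq_ker]
  exact binomial_mem_ker _ (by rw [weight_equivFunOnFinite, weight_equivFunOnFinite, h])

theorem sumElim_eq_add (s : σ →₀ ℕ) (t : τ →₀ ℕ) :
    Finsupp.sumElim s t = s.mapDomain Sum.inl + t.mapDomain Sum.inr := by
  ext (i | j)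
  · rw [Finsupp.add_apply, Finsupp.mapDomain_apply Sum.inl_injective,
      Finsupp.mapDomain_of_notMem_range _ _ (by simp)]
    simp
  · rw [Finsupp.add_apply, Finsupp.mapDomain_apply Sum.inr_injective,
      Finsupp.mapDomain_of_notMem_range _ _ (by simp)]
    simp

theorem monomial_sumElim (s : σ →₀ ℕ) (t : τ →₀ ℕ) :
    (monomial (Finsupp.sumElim s t) 1 : MvPolynomial (σ ⊕ τ) K) =
      inclusion K Sum.inl (monomial s 1) * inclusion K Sum.inr (monomial t 1) := by
  change _ = rename Sum.inl _ * rename Sum.inr _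
  rw [rename_monomial, rename_monomial, monomial_mul, mul_one, sumElim_eq_add]

theorem exists_sumElim (s : σ ⊕ τ →₀ ℕ) : ∃ t u, s = Finsupp.sumElim t u := by
  obtain ⟨⟨t, u⟩, rfl⟩ := Finsupp.sumFinsuppEquivProdFinsupp.symm.surjective s
  exact ⟨t, u, rfl⟩

theorem weight_sumElim {M : Type*} [AddCommMonoid M] (w : σ ⊕ τ → M) (s : σ →₀ ℕ) (t : τ →₀ ℕ) :
    Finsupp.weight w (Finsupp.sumElim s t) =
      Finsupp.weight (w ∘ Sum.inl) s + Finsupp.weight (w ∘ Sum.inr) t := by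
  rw [sumElim_eq_add, map_add, Finsupp.weight_apply, Finsupp.weight_apply, Finsupp.weight_apply,
    Finsupp.weight_apply, Finsupp.sum_mapDomain_index (by simp) (by intros; rw [add_smul]),
    Finsupp.sum_mapDomain_index (by simp) (by intros; rw [add_smul])]
  rfl

variable (a : σ → Fin r → ℕ) (b : τ → Fin r → ℕ)

/-- The extension to `K[x, y]` of the sum of the toric ideals of `a` and `b`. -/
def sumToricIdeal (K : Type u) [Field K] : Ideal (MvPolynomial (σ ⊕ τ) K) :=
  (toricIdeal K a).map (inclusion K Sum.inl) ⊔ (toricIdeal K b).map (inclusion K Sum.inr)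

theorem binomial_mem_sumToricIdeal {s s' : σ →₀ ℕ} {t t' : τ →₀ ℕ}
    (h : Finsupp.weight a s = Finsupp.weight a s') (h' : Finsupp.weight b t = Finsupp.weight b t') :
    (monomial (Finsupp.sumElim s t) 1 - monomial (Finsupp.sumElim s' t') 1) ∈
      sumToricIdeal a b K := by
  have e : (monomial (Finsupp.sumElim s t) 1 - monomial (Finsupp.sumElim s' t') 1 :
        MvPolynomial (σ ⊕ τ) K) =
      inclusion K Sum.inr (monomial t 1) * inclusion K Sum.inl (monomial s 1 - monomial s' 1) +
      inclusion K Sum.inl (monomial s' 1) * inclusion K Sum.inr (monomial t 1 - monomial t' 1) := by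
    rw [monomial_sumElim, monomial_sumElim, map_sub, map_sub]
    ring
  rw [e]
  exact Submodule.add_mem_sup
    (Ideal.mul_mem_left _ _ (Ideal.mem_map_of_mem _ (binomial_mem_toricIdeal a h)))
    (Ideal.mul_mem_left _ _ (Ideal.mem_map_of_mem _ (binomial_mem_toricIdeal b h')))

/-- The exponents of the embedding of `K[S₁] ⊗ K[S₂]` into a polynomial ring. -/
def productWeight : σ ⊕ τ → Fin r ⊕ Fin r → ℕ :=
  Sum.elim (fun i => Sum.elim (a i) 0) (fun j => Sum.elim 0 (b j))

theorem weight_productWeight (s : σ →₀ ℕ) (t : τ →₀ ℕ) :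
    Finsupp.weight (productWeight a b) (Finsupp.sumElim s t) =
      Sum.elim (Finsupp.weight a s) (Finsupp.weight b t) := by
  rw [weight_sumElim]
  funext k
  rcases k with k | k <;>
    simp [Finsupp.weight_apply, Finsupp.sum, productWeight, Finset.sum_apply]

theorem inclusion_inl_monomial (s : σ →₀ ℕ) :
    inclusion K (Sum.inl : σ → σ ⊕ τ) (monomial s 1) = monomial (Finsupp.sumElim s 0) 1 := by
  rw [monomial_sumElim, show monomial (0 : τ →₀ ℕ) (1 : K) = 1 from rfl,
    map_one (inclusion K (Sum.inr : τ → σ ⊕ τ)), mul_one]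

theorem inclusion_inr_monomial (t : τ →₀ ℕ) :
    inclusion K (Sum.inr : τ → σ ⊕ τ) (monomial t 1) = monomial (Finsupp.sumElim 0 t) 1 := by
  rw [monomial_sumElim, show monomial (0 : σ →₀ ℕ) (1 : K) = 1 from rfl,
    map_one (inclusion K (Sum.inl : σ → σ ⊕ τ)), one_mul]

theorem sumToricIdeal_le {J : Ideal (MvPolynomial (σ ⊕ τ) K)}
    (ha : ∀ s s', Finsupp.weight a s = Finsupp.weight a s' →
      (monomial (Finsupp.sumElim s 0) 1 - monomial (Finsupp.sumElim s' 0) 1) ∈ J)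
    (hb : ∀ t t', Finsupp.weight b t = Finsupp.weight b t' →
      (monomial (Finsupp.sumElim 0 t) 1 - monomial (Finsupp.sumElim 0 t') 1) ∈ J) :
    sumToricIdeal a b K ≤ J := by
  refine sup_le (Ideal.map_le_iff_le_comap.2 (toricIdeal_le a _ fun s s' h => ?_))
    (Ideal.map_le_iff_le_comap.2 (toricIdeal_le b _ fun t t' h => ?_))
  · rw [Ideal.mem_comap, map_sub, inclusion_inl_monomial, inclusion_inl_monomial]
    exact ha s s' h
  · rw [Ideal.mem_comap, map_sub, inclusion_inr_monomial, inclusion_inr_monomial]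
    exact hb t t' h

/-- With the two families placed in disjoint blocks of `t`-variables, equality of weights means
equality in each block, so every binomial of the kernel splits into one from each side. The point is
that the ideal becomes the kernel of a map to a domain, hence prime. -/
theorem sumToricIdeal_eq_ker : sumToricIdeal a b K = RingHom.ker
    (monomialHom K fun i => Finsupp.equivFunOnFinite.symm (productWeight a b i)) := by
  refine le_antisymm (sumToricIdeal_le a b (fun s s' h => ?_) fun t t' h => ?_)
    (ker_monomialHom_le _ _ fun s s' h => ?_)
  · exact binomial_mem_ker _ (by
      rw [weight_equivFunOnFinite, weight_equivFunOnFinite, weight_productWeight,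
        weight_productWeight, h])
  · exact binomial_mem_ker _ (by
      rw [weight_equivFunOnFinite, weight_equivFunOnFinite, weight_productWeight,
        weight_productWeight, h])
  · obtain ⟨s, t, rfl⟩ := exists_sumElim s
    obtain ⟨s', t', rfl⟩ := exists_sumElim s'
    rw [weight_equivFunOnFinite, weight_equivFunOnFinite, weight_productWeight,
      weight_productWeight] at h
    have h' := Finsupp.equivFunOnFinite.symm.injective h
    exact binomial_mem_sumToricIdeal a b (funext fun k => congrFun h' (Sum.inl k))
      (funext fun k => congrFun h' (Sum.inr k))

variable {a b}

/-- In the first block of variables the two monomials have weights `Finsupp.weight a s` and `0`, so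
their images are different monomials. -/
theorem binomial_notMem_sumToricIdeal {s : σ →₀ ℕ} {t : τ →₀ ℕ} (hs : Finsupp.weight a s ≠ 0) :
    (monomial (Finsupp.sumElim s 0) 1 - monomial (Finsupp.sumElim 0 t) 1) ∉
      sumToricIdeal a b K := by
  intro h
  rw [sumToricIdeal_eq_ker, RingHom.mem_ker, map_sub, monomialHom_monomial, monomialHom_monomial,
    sub_eq_zero, weight_equivFunOnFinite, weight_equivFunOnFinite, weight_productWeight,
    weight_productWeight] at h
  have h' := Finsupp.equivFunOnFinite.symm.injective
    (monomial_left_injective (one_ne_zero' K) h)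
  exact hs (funext fun k => (congrFun h' (Sum.inl k)).trans (by simp))

theorem mem_sumToricIdeal_of_mul_mem {s : σ →₀ ℕ} {t : τ →₀ ℕ} (hs : Finsupp.weight a s ≠ 0)
    (g : MvPolynomial (σ ⊕ τ) K)
    (hg : (monomial (Finsupp.sumElim s 0) 1 - monomial (Finsupp.sumElim 0 t) 1) * g ∈
      sumToricIdeal a b K) : g ∈ sumToricIdeal a b K := by
  have hp : (sumToricIdeal a b K).IsPrime := by
    rw [sumToricIdeal_eq_ker]
    exact RingHom.ker_isPrime _
  exact (hp.mem_or_mem hg).resolve_left (binomial_notMem_sumToricIdeal hs)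

theorem weight_mem_groupSpan (w : σ → Fin r → ℕ) (s : σ →₀ ℕ) :
    (fun k => (Finsupp.weight w s k : ℤ)) ∈ groupSpan (affineSemigroup w) := by
  suffices Finsupp.weight w s ∈ affineSemigroup w from
    AddSubgroup.subset_closure (Set.mem_image_of_mem (fun v k => (v k : ℤ)) this)
  rw [Finsupp.weight_apply]
  exact sum_mem fun i _ => nsmul_mem (AddSubmonoid.subset_closure (Set.mem_range_self i)) _

/-- The toric ideal of a gluing is generated by the toric ideals of the two parts and the gluing
binomial. -/
theorem toricIdeal_gluing {α : Fin r → ℕ}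
    (hglue : groupSpan (affineSemigroup a) ⊓ groupSpan (affineSemigroup b) =
      AddSubgroup.zmultiples (fun k => (α k : ℤ)))
    {μ : σ →₀ ℕ} {ν : τ →₀ ℕ} (hμ : Finsupp.weight a μ = α) (hν : Finsupp.weight b ν = α) :
    toricIdeal K (Sum.elim a b) = Ideal.span
      {monomial (Finsupp.sumElim μ 0) 1 - monomial (Finsupp.sumElim 0 ν) 1} ⊔
        sumToricIdeal a b K := by
  set f : MvPolynomial (σ ⊕ τ) K :=
    monomial (Finsupp.sumElim μ 0) 1 - monomial (Finsupp.sumElim 0 ν) 1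
  have hw (s : σ →₀ ℕ) (t : τ →₀ ℕ) : Finsupp.weight (Sum.elim a b) (Finsupp.sumElim s t) =
      Finsupp.weight a s + Finsupp.weight b t := weight_sumElim _ s t
  refine le_antisymm (toricIdeal_le _ _ fun s s' h => ?_) (sup_le ?_ ?_)
  · -- it suffices to treat the case that the difference of the degrees is a multiple of `α`
    have main (k : ℕ) (s s' : σ →₀ ℕ) (t t' : τ →₀ ℕ)
        (hs : Finsupp.weight a s = Finsupp.weight a s' + k • α)
        (ht : Finsupp.weight b t' = Finsupp.weight b t + k • α) :
        monomial (Finsupp.sumElim s t) 1 - monomial (Finsupp.sumElim s' t') 1 ∈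
          Ideal.span {f} ⊔ sumToricIdeal a b K := by
      -- The difference telescopes through `x^{s'} (x^μ)^k y^t` and `x^{s'} y^t (y^ν)^k`: the outer
      -- two steps lie in the sum of the toric ideals, the middle one is divisible by `f`.
      have h₁ := binomial_mem_sumToricIdeal (K := K) a b (s := s) (s' := s' + k • μ) (t := t)
        (t' := t) (by rw [hs, map_add, map_nsmul, hμ]) rfl
      have h₂ := binomial_mem_sumToricIdeal (K := K) a b (s := s') (s' := s') (t := t + k • ν)
        (t' := t') rfl (by rw [ht, map_add, map_nsmul, hν])
      have h₃ : monomial (Finsupp.sumElim (s' + k • μ) t) 1 -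
          monomial (Finsupp.sumElim s' (t + k • ν)) 1 ∈ Ideal.span {f} := by
        have hm (c : σ ⊕ τ →₀ ℕ) : (monomial (Finsupp.sumElim s' t + k • c) 1 :
            MvPolynomial (σ ⊕ τ) K) = monomial (Finsupp.sumElim s' t) 1 * monomial c 1 ^ k := by
          rw [monomial_pow, one_pow, monomial_mul, one_mul]
        have e₁ : Finsupp.sumElim (s' + k • μ) t =
            Finsupp.sumElim s' t + k • Finsupp.sumElim μ 0 := by ext (i | j) <;> simp
        have e₂ : Finsupp.sumElim s' (t + k • ν) =
            Finsupp.sumElim s' t + k • Finsupp.sumElim 0 ν := by ext (i | j) <;> simp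
        rw [e₁, e₂, hm, hm, ← mul_sub]
        exact Ideal.mul_mem_left _ _ (Ideal.mem_span_singleton.2 (sub_dvd_pow_sub_pow _ _ k))
      have := add_mem (add_mem (Ideal.mem_sup_right (S := Ideal.span {f}) h₁)
        (Ideal.mem_sup_left (T := sumToricIdeal a b K) h₃))
        (Ideal.mem_sup_right (S := Ideal.span {f}) h₂)
      simpa using this
    obtain ⟨s, t, rfl⟩ := exists_sumElim s
    obtain ⟨s', t', rfl⟩ := exists_sumElim s'
    rw [hw, hw] at h
    have hk (k : Fin r) : (Finsupp.weight a s k : ℤ) + Finsupp.weight b t k =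
        Finsupp.weight a s' k + Finsupp.weight b t' k := by exact_mod_cast congrFun h k
    -- The change of degree in the `x`-part is the opposite of that in the `y`-part, so it lies in
    -- both groups.
    have hdiff : (fun k => (Finsupp.weight a s k : ℤ)) - (fun k => (Finsupp.weight a s' k : ℤ)) ∈
        AddSubgroup.zmultiples (fun k => (α k : ℤ)) := by
      rw [← hglue]
      refine AddSubgroup.mem_inf.2
        ⟨sub_mem (weight_mem_groupSpan a s) (weight_mem_groupSpan a s'), ?_⟩
      convert sub_mem (weight_mem_groupSpan b t') (weight_mem_groupSpan b t) using 1
      funext k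
      have := hk k
      simp only [Pi.sub_apply]
      omega
    obtain ⟨c, hc⟩ := hdiff
    have hc' (k : Fin r) : c * (α k : ℤ) = Finsupp.weight a s k - Finsupp.weight a s' k := by
      simpa using congrFun hc k
    obtain ⟨n, rfl | rfl⟩ := Int.eq_nat_or_neg c
    · refine main n s s' t t' (funext fun k => ?_) (funext fun k => ?_) <;>
      · have := hk k
        have := hc' k
        simp only [Pi.add_apply, Pi.smul_apply, smul_eq_mul]
        zify
        omega
    -- For a negative multiple of `α` the two monomials exchange roles.
    · rw [← neg_sub]
      refine neg_mem (main n s' s t' t (funext fun k => ?_) (funext fun k => ?_)) <;>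
      · have := hk k
        have := hc' k
        simp only [Pi.add_apply, Pi.smul_apply, smul_eq_mul]
        zify
        rw [neg_mul] at this
        omega
  · rw [Ideal.span_singleton_le_iff_mem]
    exact binomial_mem_toricIdeal _ (by rw [hw, hw, hμ, hν, map_zero, map_zero, add_zero, zero_add])
  · exact sumToricIdeal_le a b (fun s s' h => binomial_mem_toricIdeal _ (by rw [hw, hw, h]))
      fun t t' h => binomial_mem_toricIdeal _ (by rw [hw, hw, h])

theorem gluingBinomial_eq {m n : ℕ} (μ : Fin m → ℕ) (ν : Fin n → ℕ) :
    gluingBinomial K μ ν =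
      monomial (Finsupp.sumElim (Finsupp.equivFunOnFinite.symm μ) 0) 1 -
        monomial (Finsupp.sumElim 0 (Finsupp.equivFunOnFinite.symm ν)) 1 := by
  rw [gluingBinomial]
  congr 1 <;>
  · rw [monomial_eq, C_1, one_mul, Finsupp.prod_fintype _ _ (by simp), Fintype.prod_sum_type]
    simp

theorem monomial_mem_span_X {s : σ →₀ ℕ} (hs : s ≠ 0) :
    (monomial s 1 : MvPolynomial σ K) ∈ Ideal.span (Set.range X) := by
  obtain ⟨i, hi⟩ := Finsupp.ne_iff.1 hs
  have : (X i : MvPolynomial σ K) ∣ monomial s 1 := by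
    rw [X_dvd_monomial]
    exact Or.inr hi
  exact Ideal.mem_of_dvd _ this (Ideal.subset_span ⟨i, rfl⟩)

end Toric

/-! ### Extension of scalars of minimal graded free resolutions -/

section ExtensionOfScalars

variable {K : Type u} [Field K] {σ τ : Type} {r : ℕ} (ι : σ → τ)
  (F : ChainComplex (ModuleCat.{u} (MvPolynomial σ K)) ℕ)

/-- The terms of the extension of scalars of a complex, as tensor products of modules. -/
def extendEquiv (i : ℕ) : letI := (inclusion K ι).toAlgebra
    (MvPolynomial τ K ⊗[MvPolynomial σ K] F.X i) ≃ₗ[MvPolynomial τ K] (extend ι F).X i :=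
  letI := (inclusion K ι).toAlgebra
  LinearEquiv.refl (MvPolynomial τ K) (MvPolynomial τ K ⊗[MvPolynomial σ K] F.X i)

theorem extendEquiv_d (i j : ℕ) : letI := (inclusion K ι).toAlgebra
    ∀ z : MvPolynomial τ K ⊗[MvPolynomial σ K] F.X i,
      ((extend ι F).d i j).hom (extendEquiv ι F i z) =
        extendEquiv ι F j ((F.d i j).hom.baseChange (MvPolynomial τ K) z) :=
  fun _ => rfl

variable {ι F} {grF : ∀ i, (Fin r → ℕ) → AddSubgroup (F.X i)} {w : τ → Fin r → ℕ}

theorem extendGrading_eq (i : ℕ) (t : Fin r → ℕ) :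
    letI := (inclusion K ι).toAlgebra
    extendGrading ι w F grF i t = AddSubgroup.closure
      {z | ∃ (d s : Fin r → ℕ) (c : MvPolynomial τ K) (x : F.X i),
        MvPolynomial.IsWeightedHomogeneous w c d ∧ x ∈ grF i s ∧ d + s = t ∧
        z = extendEquiv ι F i (c ⊗ₜ[MvPolynomial σ K] x)} := rfl

theorem isWeightedHomogeneous_inclusion {c : MvPolynomial σ K} {d : Fin r → ℕ}
    (hc : MvPolynomial.IsWeightedHomogeneous (w ∘ ι) c d) :
    MvPolynomial.IsWeightedHomogeneous w (inclusion K ι c) d := by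
  intro s hs
  obtain ⟨u, rfl, hu⟩ := MvPolynomial.coeff_rename_ne_zero ι c s hs
  rw [← hc hu, Finsupp.weight_apply, Finsupp.weight_apply,
    Finsupp.sum_mapDomain_index (by simp) (by intros; rw [add_smul])]
  rfl

theorem exact_baseChange {A B : Type*} [CommRing A] [CommRing B] [Algebra A B] [Module.Flat A B]
    {M N P : Type*} [AddCommGroup M] [AddCommGroup N] [AddCommGroup P] [Module A M] [Module A N]
    [Module A P] {f : M →ₗ[A] N} {g : N →ₗ[A] P} (h : Function.Exact f g) :
    Function.Exact (f.baseChange B) (g.baseChange B) :=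
  Module.Flat.lTensor_exact B h

theorem affineSemigroup_comp_le : affineSemigroup (w ∘ ι) ≤ affineSemigroup w :=
  AddSubmonoid.closure_mono (Set.range_comp_subset_range _ _)

/-- The elements `1 ⊗ e_j` form a basis with unchanged shifts; coefficients from the smaller ring
move across the tensor sign and keep their degree. -/
theorem isGradedFree_extendGrading (hF : ∀ i, IsGradedFree (K := K) (w ∘ ι) (grF i)) (i : ℕ) :
    IsGradedFree (K := K) w (extendGrading ι w F grF i) := by
  let := (inclusion K ι).toAlgebra
  obtain ⟨β, e, s, hs, hgr⟩ := hF i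
  refine isGradedFree_of_basis ((e.baseChange (MvPolynomial τ K)).map (extendEquiv ι F i)) s
    (fun j => affineSemigroup_comp_le (hs j)) fun t => ?_
  have hbasis (c : MvPolynomial τ K) (j : Fin β) :
      c • ((e.baseChange (MvPolynomial τ K)).map (extendEquiv ι F i)) j =
        extendEquiv ι F i (c ⊗ₜ[MvPolynomial σ K] e j) := by
    rw [Module.Basis.map_apply, Module.Basis.baseChange_apply, ← map_smul,
      TensorProduct.smul_tmul', smul_eq_mul, mul_one]
  simp only [hbasis]
  rw [extendGrading_eq]
  refine le_antisymm ((AddSubgroup.closure_le _).2 ?_) ((AddSubgroup.closure_le _).2 ?_)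
  · rintro _ ⟨d, s', c, x, hc, hx, rfl, rfl⟩
    rw [hgr] at hx
    refine map_mem_of_mem_closure ((extendEquiv ι F i).toLinearMap.toAddMonoidHom.comp
      (TensorProduct.mk (MvPolynomial σ K) (MvPolynomial τ K) (F.X i) c).toAddMonoidHom) ?_ hx
    rintro _ ⟨j, d', c', hc', rfl, rfl⟩
    refine AddSubgroup.subset_closure ⟨j, d + d', c * inclusion K ι c',
      hc.mul (isWeightedHomogeneous_inclusion hc'), add_assoc _ _ _, ?_⟩
    refine congrArg (extendEquiv ι F i) ?_
    refine (TensorProduct.smul_tmul c' c (e j)).symm.trans ?_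
    rw [Algebra.smul_def, mul_comm]
    rfl
  · rintro _ ⟨j, d, c, hc, rfl, rfl⟩
    refine AddSubgroup.subset_closure ⟨d, s j, c, e j, hc, ?_, rfl, rfl⟩
    rw [hgr]
    exact AddSubgroup.subset_closure
      ⟨j, 0, 1, MvPolynomial.isWeightedHomogeneous_one K _, zero_add _, (one_smul _ _).symm⟩

/-- Flat extension of scalars along an inclusion of variables preserves minimal graded free
resolutions. -/
theorem IsMinimalGradedFreeResolution.extend (hι : (inclusion K ι).Flat)
    {I : Ideal (MvPolynomial σ K)} (hF : IsMinimalGradedFreeResolution (w ∘ ι) I F grF) :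
    IsMinimalGradedFreeResolution w (I.map (inclusion K ι)) (extend ι F)
      (extendGrading ι w F grF) := by
  let := (inclusion K ι).toAlgebra
  have : Module.Flat (MvPolynomial σ K) (MvPolynomial τ K) := hι
  refine ⟨?_, isGradedFree_extendGrading hF.free, ?_, ?_, ?_, ?_⟩
  · obtain ⟨k, hk⟩ := hF.bounded
    refine ⟨k, fun i hi => ?_⟩
    have := hk i hi
    exact (extendEquiv ι F i).symm.injective.subsingleton
  · intro i t x hx
    rw [extendGrading_eq] at hx
    refine map_mem_of_mem_closure ((Gluing.extend ι F).d (i + 1) i).hom.toAddMonoidHom ?_ hx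
    rintro _ ⟨d, s, c, x, hc, hx, hd, rfl⟩
    exact AddSubgroup.subset_closure ⟨d, s, c, _, hc, hF.homogeneous i s x hx, hd, rfl⟩
  · intro i
    exact exact_baseChange (B := MvPolynomial τ K) (hF.exact i)
  · obtain ⟨ε, hε, hFε, hgr⟩ := hF.augmentation
    let q := (Ideal.qoutMapEquivTensorQout (MvPolynomial τ K) (I := I)).symm
    have hq (c : MvPolynomial τ K) (a : MvPolynomial σ K) :
        q (c ⊗ₜ Ideal.Quotient.mk I a) =
          Ideal.Quotient.mk (I.map (inclusion K ι)) (c * inclusion K ι a) := by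
      -- `q` unfolds to `tensorQuotEquivQuotSMul` followed by the identification of `I • ⊤` with the
      -- extended ideal, so its value on a pure tensor is read off from `h`.
      have h := TensorProduct.tensorQuotEquivQuotSMul_tmul_mk I c a
      rw [Algebra.smul_def, mul_comm] at h
      exact congrArg (Submodule.quotEquivOfEq (I • (⊤ : Submodule (MvPolynomial σ K) _))
        ((I.map (inclusion K ι)).restrictScalars _) (by simp; rfl) ≪≫ₗ
          Submodule.Quotient.restrictScalarsEquiv (MvPolynomial σ K) _) h
    refine ⟨q.toLinearMap ∘ₗ ε.baseChange (MvPolynomial τ K) ∘ₗ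
      (extendEquiv ι F 0).symm.toLinearMap, ?_, ?_, ?_⟩
    · exact q.surjective.comp ((LinearMap.lTensor_surjective _ hε).comp
        (extendEquiv ι F 0).symm.surjective)
    · intro z
      refine (map_eq_zero_iff q q.injective).trans ?_
      exact exact_baseChange (B := MvPolynomial τ K) hFε z
    · intro t x hx
      rw [extendGrading_eq] at hx
      have := map_mem_of_mem_closure
        (H := (((MvPolynomial.weightedHomogeneousSubmodule K w t).toAddSubgroup).map
          (Ideal.Quotient.mk (I.map (inclusion K ι))).toAddMonoidHom))
        (q.toLinearMap ∘ₗ ε.baseChange (MvPolynomial τ K) ∘ₗ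
          (extendEquiv ι F 0).symm.toLinearMap).toAddMonoidHom ?_ hx
      · obtain ⟨c, hc, hc'⟩ := this
        exact ⟨c, hc, hc'.symm⟩
      rintro _ ⟨d, s, c, y, hc, hy, rfl, rfl⟩
      obtain ⟨a, ha, ha'⟩ := hgr s y hy
      refine ⟨c * inclusion K ι a, hc.mul (isWeightedHomogeneous_inclusion ha), ?_⟩
      refine (hq c a).symm.trans ?_
      rw [← ha']
      rfl
  · rintro i _ ⟨z, rfl⟩
    have hm : (Ideal.span (Set.range (MvPolynomial.X : σ → MvPolynomial σ K))).map (inclusion K ι) ≤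
        Ideal.span (Set.range (MvPolynomial.X : τ → MvPolynomial τ K)) := by
      rw [Ideal.map_span, Ideal.span_le]
      rintro _ ⟨_, ⟨j, rfl⟩, rfl⟩
      exact Ideal.subset_span ⟨ι j, (MvPolynomial.rename_X ι j).symm⟩
    obtain ⟨z, rfl⟩ := (extendEquiv ι F (i + 1)).surjective z
    rw [extendEquiv_d]
    refine map_mem_smul_top _ (extendEquiv ι F i).toLinearMap ?_
    induction z using TensorProduct.induction_on with
    | zero => rw [map_zero]; exact zero_mem _
    | add x y hx hy => rw [map_add]; exact add_mem hx hy
    | tmul c x =>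
      rw [LinearMap.baseChange_tmul]
      have hx := hF.minimal i ⟨x, rfl⟩
      generalize (F.d (i + 1) i).hom x = x' at hx
      induction hx using Submodule.smul_induction_on' with
      | smul a ha y _ =>
        rw [← TensorProduct.smul_tmul, Algebra.smul_def, ← smul_eq_mul, ← TensorProduct.smul_tmul']
        exact Submodule.smul_mem_smul (hm (Ideal.mem_map_of_mem _ ha)) trivial
      | add y _ y' _ hy hy' =>
        rw [TensorProduct.tmul_add]
        exact add_mem hy hy'

end ExtensionOfScalars

/-! ### The resolution of the toric ideal of a gluing -/

/-- The complex `C_{f_α} ⊗ F ⊗ G`, for resolutions `F` and `G` over `K[x, y]` of the extensions of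
the two toric ideals, is a minimal graded free resolution of the toric ideal of the gluing. -/
theorem isMinimalGradedFreeResolution_gluing {K : Type u} [Field K] {r m n : ℕ}
    {a : Fin m → Fin r → ℕ} {b : Fin n → Fin r → ℕ} {α : Fin r → ℕ}
    (hglue : IsGluing (affineSemigroup (Sum.elim a b)) (affineSemigroup a) (affineSemigroup b) α)
    {μ : Fin m → ℕ} {ν : Fin n → ℕ} (hμ : α = ∑ i, μ i • a i) (hν : α = ∑ j, ν j • b j)
    {F : ChainComplex (ModuleCat.{u} (MvPolynomial (Fin m ⊕ Fin n) K)) ℕ}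
    {grF : ∀ i, (Fin r → ℕ) → AddSubgroup (F.X i)}
    {G : ChainComplex (ModuleCat.{u} (MvPolynomial (Fin m ⊕ Fin n) K)) ℕ}
    {grG : ∀ i, (Fin r → ℕ) → AddSubgroup (G.X i)}
    (hF : IsMinimalGradedFreeResolution (Sum.elim a b)
      ((toricIdeal K a).map (inclusion K Sum.inl)) F grF)
    (hG : IsMinimalGradedFreeResolution (Sum.elim a b)
      ((toricIdeal K b).map (inclusion K Sum.inr)) G grG) :
    IsMinimalGradedFreeResolution (Sum.elim a b) (toricIdeal K (Sum.elim a b))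
      (twoTermComplex (gluingBinomial K μ ν) ⊗ (F ⊗ G))
      (tensorGrading _ _ (twoTermGrading (Sum.elim a b) (gluingBinomial K μ ν) α)
        (tensorGrading _ _ grF grG)) := by
  have hμ' : Finsupp.weight a (Finsupp.equivFunOnFinite.symm μ) = α := by
    rw [hμ, Finsupp.weight_apply, Finsupp.sum_fintype _ _ (by simp)]
    rfl
  have hν' : Finsupp.weight b (Finsupp.equivFunOnFinite.symm ν) = α := by
    rw [hν, Finsupp.weight_apply, Finsupp.sum_fintype _ _ (by simp)]
    rfl
  have hμ0 : Finsupp.weight a (Finsupp.equivFunOnFinite.symm μ) ≠ 0 := hμ'.symm ▸ hglue.ne_zero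
  rw [gluingBinomial_eq]
  set s := Finsupp.sumElim (Finsupp.equivFunOnFinite.symm μ) (0 : Fin n →₀ ℕ)
  set t := Finsupp.sumElim (0 : Fin m →₀ ℕ) (Finsupp.equivFunOnFinite.symm ν)
  have hsw : Finsupp.weight (Sum.elim a b) s = α := by
    rw [weight_sumElim, map_zero, add_zero]
    exact hμ'
  have htw : Finsupp.weight (Sum.elim a b) t = α := by
    rw [weight_sumElim, map_zero, zero_add]
    exact hν'
  have hs0 : s ≠ 0 := by
    intro h
    rw [h, map_zero] at hsw
    exact hglue.ne_zero hsw.symm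
  have ht0 : t ≠ 0 := by
    intro h
    rw [h, map_zero] at htw
    exact hglue.ne_zero htw.symm
  have hfJ := mem_sumToricIdeal_of_mul_mem (K := K) (b := b)
    (t := Finsupp.equivFunOnFinite.symm ν) hμ0
  have hf := binomial_notMem_sumToricIdeal (K := K) (b := b)
    (t := Finsupp.equivFunOnFinite.symm ν) hμ0
  rw [toricIdeal_gluing hglue.inf_eq hμ' hν']
  -- The inner product resolves the sum of the two extended toric ideals. In the outer one `C_f` is
  -- the left factor, so only regularity of `f` modulo that sum is required.
  refine (isMinimalGradedFreeResolution_twoTerm ?_ ?_ ?_ ?_).tensor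
    (hF.tensor hG (exact_mod_inclusion (toricIdeal K b) hF)) (twoTerm_exact_mod hfJ)
  · exact (MvPolynomial.weightedHomogeneousSubmodule K (Sum.elim a b) α).sub_mem
      (MvPolynomial.isWeightedHomogeneous_monomial _ _ _ hsw)
      (MvPolynomial.isWeightedHomogeneous_monomial _ _ _ htw)
  · rw [hglue.eq_sup]
    exact (le_sup_left : affineSemigroup a ≤ _) hglue.mem_left
  · intro h
    exact hf (h ▸ zero_mem _)
  · exact sub_mem (monomial_mem_span_X hs0) (monomial_mem_span_X ht0)

end Gluing

end

theorem theorem3p2 (K : Type u) [Field K] (r m n : ℕ)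
    (a : Fin m → Fin r → ℕ) (b : Fin n → Fin r → ℕ) (ha : ∀ i, a i ≠ 0) (hb : ∀ j, b j ≠ 0)
    (α : Fin r → ℕ)
    (hglue : Gluing.IsGluing (Gluing.affineSemigroup (Sum.elim a b))
      (Gluing.affineSemigroup a) (Gluing.affineSemigroup b) α)
    (μ : Fin m → ℕ) (ν : Fin n → ℕ) (hμ : α = ∑ i, μ i • a i) (hν : α = ∑ j, ν j • b j) :
    -- resolutions `F`, `G` over `K[x]`, `K[y]`, extended to `R = K[x, y]`
    (∀ (F : ChainComplex (ModuleCat.{u} (MvPolynomial (Fin m) K)) ℕ)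
      (grF : ∀ i, (Fin r → ℕ) → AddSubgroup (F.X i))
      (G : ChainComplex (ModuleCat.{u} (MvPolynomial (Fin n) K)) ℕ)
      (grG : ∀ i, (Fin r → ℕ) → AddSubgroup (G.X i)),
      Gluing.IsMinimalGradedFreeResolution a (Gluing.toricIdeal K a) F grF →
      Gluing.IsMinimalGradedFreeResolution b (Gluing.toricIdeal K b) G grG →
      Gluing.IsMinimalGradedFreeResolution (Sum.elim a b) (Gluing.toricIdeal K (Sum.elim a b))
        (Gluing.twoTermComplex (Gluing.gluingBinomial K μ ν) ⊗
          (Gluing.extend Sum.inl F ⊗ Gluing.extend Sum.inr G))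
        (Gluing.tensorGrading _ _
          (Gluing.twoTermGrading (Sum.elim a b) (Gluing.gluingBinomial K μ ν) α)
          (Gluing.tensorGrading _ _
            (Gluing.extendGrading Sum.inl (Sum.elim a b) F grF)
            (Gluing.extendGrading Sum.inr (Sum.elim a b) G grG)))) ∧
    -- resolutions `F`, `G` given directly over `R = K[x, y]`
    (∀ (F : ChainComplex (ModuleCat.{u} (MvPolynomial (Fin m ⊕ Fin n) K)) ℕ)
      (grF : ∀ i, (Fin r → ℕ) → AddSubgroup (F.X i))
      (G : ChainComplex (ModuleCat.{u} (MvPolynomial (Fin m ⊕ Fin n) K)) ℕ)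
      (grG : ∀ i, (Fin r → ℕ) → AddSubgroup (G.X i)),
      Gluing.IsMinimalGradedFreeResolution (Sum.elim a b)
        ((Gluing.toricIdeal K a).map (Gluing.inclusion K Sum.inl)) F grF →
      Gluing.IsMinimalGradedFreeResolution (Sum.elim a b)
        ((Gluing.toricIdeal K b).map (Gluing.inclusion K Sum.inr)) G grG →
      Gluing.IsMinimalGradedFreeResolution (Sum.elim a b) (Gluing.toricIdeal K (Sum.elim a b))
        (Gluing.twoTermComplex (Gluing.gluingBinomial K μ ν) ⊗ (F ⊗ G))
        (Gluing.tensorGrading _ _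
          (Gluing.twoTermGrading (Sum.elim a b) (Gluing.gluingBinomial K μ ν) α)
          (Gluing.tensorGrading _ _ grF grG))) := by
  exact ⟨fun F grF G grG hF hG => Gluing.isMinimalGradedFreeResolution_gluing hglue hμ hν
      (Gluing.IsMinimalGradedFreeResolution.extend (w := Sum.elim a b) Gluing.flat_inclusion_inl hF)
      (Gluing.IsMinimalGradedFreeResolution.extend (w := Sum.elim a b) Gluing.flat_inclusion_inr hG),
    fun F grF G grG hF hG => Gluing.isMinimalGradedFreeResolution_gluing hglue hμ hν hF hG⟩
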